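/- Let $0<\alpha<1$, let $\tilde\Lambda(dx)=\alpha x^{-\alpha-1}dx$ on $(0,1)$, and let $r,n\in\mathbb{N}=\{1,2,\dots\}$. For $m\in\mathbb{N}$, $\mathcal{BN}(m,\tilde\Lambda)$ denotes the law of a random point measure $\mathbb{B}^{(m)}$ on $(0,1)$ with Laplace functional $$\mathbf{E}\,e^{-\mathbb{B}^{(m)}(f)}=\Big(1+\int_0^1(1-e^{-f(x)})\,\tilde\Lambda(dx)\Big)^{-m}$$ for all measurable $f:(0,1)\to[0,\infty)$, and ${}^{(m)}T=\int x\,\mathbb{B}^{(m)}(dx)$ denotes the sum of its points. Let $\mathbb{B}^{(r)}$ have law $\mathcal{BN}(r,\tilde\Lambda)$ and let $(\tilde J_1,\tilde J_2,\dots)$ be the size-biased random permutation of its points: for every $k\ge 0$, conditionally on $\mathbb{B}^{(r)}$ and $\tilde J_1,\dots,\tilde J_k$, the pick $\tilde J_{k+1}$ equals $x$ with probability $x/({}^{(r)}T-\sum_{l\le k}\tilde J_l)$ for each point $x$ of $\mathbb{B}^{(r)}$ other than $\tilde J_1,\dots,\tilde J_k$. Then ${}^{(r)}T$ and ${}^{(r+n)}T$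 are almost surely finite, and for distinct $x_1,\dots,x_n\in(0,1)$ and $t>\sum_{i=1}^n x_i$, $$\mathbf{P}\big(\tilde J_1\in dx_1,\dots,\tilde J_n\in dx_n,\ {}^{(r)}T\in dt\big)=r^{(n)}\alpha^n\prod_{i=1}^n\frac{x_i^{-\alpha}\,dx_i}{t-\sum_{j=1}^{i-1}x_j}\ \mathbf{P}\Big({}^{(r+n)}T\in d\Big(t-\sum_{i=1}^n x_i\Big)\Big),$$ where $r^{(n)}=r(r+1)\cdots(r+n-1)$. That is, the joint law of $(\tilde J_1,\dots,\tilde J_n,{}^{(r)}T)$ is the measure with density $r^{(n)}\alpha^n\prod_{i=1}^n x_i^{-\alpha}/(t-\sum_{j<i}x_j)$ with respect to the image of (Lebesgue measure on $(0,1)^n$) $\otimes$ (the law of ${}^{(r+n)}T$) under the map $(x,s)\mapsto(x,\,s+\sum_{i=1}^n x_i)$. -/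

import Mathlib

open MeasureTheory ProbabilityTheory
open scoped ENNReal NNReal

noncomputable section

namespace NegBin

/-- A point measure on `(0,1)`, seen as a measure on `ℝ`: a countable (finite or infinite) sum of
unit masses at points of `(0,1)`, with finite mass on every compact subset of `(0,1)`. -/
structure IsPointMeasure (M : Measure ℝ) : Prop where
  atomic : ∃ (I : Set ℕ) (x : I → ℝ), (∀ i, x i ∈ Set.Ioo (0 : ℝ) 1) ∧
    M = Measure.sum fun i => Measure.dirac (x i)
  finite_on_compact : ∀ K : Set ℝ, IsCompact K → K ⊆ Set.Ioo (0 : ℝ) 1 → M K < ∞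

/-- The measure `α x ^ (-α - 1) dx` on `(0,1)`. -/
def tildeLambda (α : ℝ) : Measure ℝ :=
  (volume.restrict (Set.Ioo (0 : ℝ) 1)).withDensity fun x => ENNReal.ofReal (α * x ^ (-α - 1))

/-- The sum `T(M) = ∑_{x ∈ M} x = ∫ x M(dx)` of the points of `M`, with multiplicity. -/
def totalSum (M : Measure ℝ) : ℝ≥0∞ := ∫⁻ x, ENNReal.ofReal x ∂M

/-- The Laplace functional `E exp (-N(f))` of a random measure `N`, with `exp (-∞) = 0`. -/
def laplaceFunctional {Ω : Type*} [MeasurableSpace Ω] (μ : Measure Ω) (N : Ω → Measure ℝ)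
    (f : ℝ → ℝ≥0) : ℝ≥0∞ :=
  ∫⁻ ω, EReal.exp (-((∫⁻ x, (f x : ℝ≥0∞) ∂(N ω) : ℝ≥0∞) : EReal)) ∂μ

/-- `N` is a negative binomial point process `BN(r, Q)` on `(0,1)`: a random point measure whose
Laplace functional is `(1 + ∫ (1 - exp (-f)) dQ) ^ (-r)` (which is `0` if the integral is `∞`).
Measurability of `N` is for the σ-algebra generated by the evaluations `M ↦ M A`. -/
structure IsNegBinomialProcess {Ω : Type*} [MeasurableSpace Ω] (μ : Measure Ω)
    (N : Ω → Measure ℝ) (r : ℕ) (Q : Measure ℝ) : Prop where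
  measurable : Measurable N
  pointMeasure : ∀ᵐ ω ∂μ, IsPointMeasure (N ω)
  laplace : ∀ f : ℝ → ℝ≥0, Measurable f →
    laplaceFunctional μ N f =
      ((1 + ∫⁻ x, ENNReal.ofReal (1 - Real.exp (-(f x : ℝ))) ∂Q) ^ r)⁻¹

/-- The law of the next size-biased pick from `M` when `y 0, …, y (k-1)` have been picked: a point
`x` of `M` different from all of these is taken with probability `x / (T(M) - ∑ l, y l)`. -/
def nextPickLaw (M : Measure ℝ) {k : ℕ} (y : Fin k → ℝ) : Measure ℝ :=
  (M.restrict {x | ∀ l, x ≠ y l}).withDensity fun x =>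
    ENNReal.ofReal (x / ((totalSum M).toReal - ∑ l, y l))

/-- The information in the random measure `N` and the first `k` picks. -/
abbrev pickSigma {Ω : Type*} (N : Ω → Measure ℝ) (J : ℕ → Ω → ℝ) (k : ℕ) : MeasurableSpace Ω :=
  MeasurableSpace.comap (fun ω => (N ω, fun l : Fin k => J l ω)) inferInstance

/-- `J 0, J 1, …` is the size-biased random permutation of the points of `N`: for every `k`, given
`N` and `J 0, …, J (k-1)`, the conditional law of `J k` is `nextPickLaw`. -/
structure IsSizeBiasedPermutation {Ω : Type*} [MeasurableSpace Ω] (μ : Measure Ω)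
    (N : Ω → Measure ℝ) (J : ℕ → Ω → ℝ) : Prop where
  measurable : ∀ k, Measurable (J k)
  condLaw : ∀ (k : ℕ) (A : Set ℝ), MeasurableSet A →
    μ⟦J k ⁻¹' A | pickSigma N J k⟧ =ᵐ[μ]
      fun ω => (nextPickLaw (N ω) (fun l : Fin k => J l ω) A).toReal

end NegBin

end

/-! Given the point measure `N` with sum `T = t`, the first `n` picks have, on tuples of distinct
points, the density `∏ 1 / (t - ∑_{j<i} x_j)` with respect to `∏ x_i N(dx_i)`; this is the chain
rule for the successive picks (`IsSizeBiasedPermutation.lintegral_eq`). The density depends on `N`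
only through `T`, so it comes out of the expectation, and there remains the moment measure `E[∏ x_i
N(dx_i); T ∈ dt]` off the diagonals.

That measure is found by differentiating the Laplace functional. For functions `h_i` with disjoint
supports, `E[∏ N(h_i) exp(-N(f))] = r⁽ⁿ⁾ (1 + ∫ (1 - e^{-f}) dQ)^{-(r+n)} ∏ ∫ h_i e^{-f} dQ`, since
each derivative in a direction `h_i` raises the exponent by one and brings down the next factor of
`r (r+1) ⋯` (`IsNegBinomialProcess.lintegral_prod_mul_expNeg`). Taking `f(x) = k x` and `h_i(x) = x
1_{B_i}(x)`, the power `-(r+n)` is the Laplace transform of the sum `T'` for index `r + n`, while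
the factors `e^{-k x_i}` shift it by `∑ x_i`. Uniqueness of Laplace transforms then gives the moment
measure on products of disjoint sets (`IsNegBinomialProcess.map_withDensity_eq`), and countably many
such products cover all tuples of distinct points
(`IsNegBinomialProcess.momentMeasure_withDensity`).

For `tildeLambda α` one has `x Q(dx) = α x^{-α} dx`, finite because `α < 1`, and the diagonals are
Lebesgue null, which gives the stated density.

Derivatives are taken in `[0, ∞]` along the steps `2⁻ʲ`: the quotients of `1 - e^{-y}` increase to
`y`, so monotone convergence replaces any domination argument. -/

namespace NegBin

/-! ### Dyadic differentiation of `exp (-y)` on `[0, ∞]` -/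

open Filter Topology

/-- The function `y ↦ exp (-y)` on `[0, ∞]`, with `exp (-∞) = 0`. -/
noncomputable def expNeg (y : ℝ≥0∞) : ℝ≥0∞ := EReal.exp (-(y : EReal))

lemma continuous_expNeg : Continuous expNeg :=
  ENNReal.continuous_exp.comp (continuous_neg.comp continuous_coe_ennreal_ereal)

lemma measurable_expNeg : Measurable expNeg := continuous_expNeg.measurable

lemma expNeg_add (x y : ℝ≥0∞) : expNeg (x + y) = expNeg x * expNeg y := by
  rw [expNeg, EReal.coe_ennreal_add, EReal.neg_add, sub_eq_add_neg, EReal.exp_add]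
  · rfl
  · exact Or.inl (EReal.coe_ennreal_ne_bot x)
  · exact Or.inr (EReal.coe_ennreal_ne_bot y)

lemma expNeg_coe (x : ℝ≥0) : expNeg x = ENNReal.ofReal (Real.exp (-(x : ℝ))) := by
  rw [expNeg, EReal.coe_nnreal_eq_coe_real, ← EReal.coe_neg, EReal.exp_coe]

lemma expNeg_ofReal {x : ℝ} (hx : 0 ≤ x) :
    expNeg (ENNReal.ofReal x) = ENNReal.ofReal (Real.exp (-x)) := by
  rw [ENNReal.ofReal, expNeg_coe, Real.coe_toNNReal _ hx]

@[simp] lemma expNeg_zero : expNeg 0 = 1 := by simp [expNeg]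

@[simp] lemma expNeg_top : expNeg ∞ = 0 := by simp [expNeg]

lemma expNeg_le_one (x : ℝ≥0∞) : expNeg x ≤ 1 := by
  rw [expNeg, EReal.exp_le_one_iff, EReal.neg_le, neg_zero]
  exact EReal.coe_ennreal_nonneg x

lemma ofReal_one_sub_exp_neg (x : ℝ≥0) :
    ENNReal.ofReal (1 - Real.exp (-(x : ℝ))) = 1 - expNeg x := by
  rw [expNeg_coe, ENNReal.ofReal_sub _ (Real.exp_nonneg _), ENNReal.ofReal_one]

/-- The dyadic difference quotients of `y ↦ 1 - exp (-y)` at `0`. -/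
noncomputable def dyadicQuotient (j : ℕ) (y : ℝ≥0∞) : ℝ≥0∞ :=
  2 ^ j * (1 - expNeg ((2 ^ j)⁻¹ * y))

lemma measurable_dyadicQuotient (j : ℕ) : Measurable (dyadicQuotient j) := by
  have h := measurable_expNeg.comp (measurable_const_mul ((2 ^ j)⁻¹ : ℝ≥0∞))
  exact (measurable_const.sub h).const_mul _

/-- The first difference of `exp (-·)` at `z` in direction `y`, written as a sum so that nothing is
subtracted in `[0, ∞]`. -/
lemma expNeg_eq_add (j : ℕ) (z y : ℝ≥0∞) :
    expNeg z = expNeg (z + (2 ^ j)⁻¹ * y) + (2 ^ j)⁻¹ * (expNeg z * dyadicQuotient j y) := by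
  rw [expNeg_add, dyadicQuotient, mul_left_comm, ← mul_assoc _ (2 ^ j) _,
    ENNReal.inv_mul_cancel (by simp) (by simp), one_mul, ← mul_add,
    add_tsub_cancel_of_le (expNeg_le_one _), mul_one]

/-- Concavity of `1 - e^{-y}`: with `q` the exponential at the halved step, the claim is `1 - q² ≤ 2
(1 - q)`, that is `(1 - q)² ≥ 0`. -/
lemma monotone_dyadicQuotient (y : ℝ≥0∞) : Monotone fun j => dyadicQuotient j y := by
  refine monotone_nat_of_le_succ fun j => ?_
  have hs : ((2 ^ j)⁻¹ : ℝ≥0∞) * y = (2 ^ (j + 1))⁻¹ * y + (2 ^ (j + 1))⁻¹ * y := by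
    have h2 : ((2 ^ j)⁻¹ : ℝ≥0∞) = (2 ^ (j + 1))⁻¹ + (2 ^ (j + 1))⁻¹ := by
      rw [← two_mul, pow_succ, ENNReal.mul_inv (by simp) (by simp), mul_left_comm,
        ENNReal.mul_inv_cancel (by simp) (by simp), mul_one]
    rw [h2, add_mul]
  simp only [dyadicQuotient]
  rw [hs, expNeg_add, pow_succ (2 : ℝ≥0∞) j, mul_assoc, ← pow_succ (2 : ℝ≥0∞) j]
  gcongr
  have hq := expNeg_le_one ((2 ^ (j + 1))⁻¹ * y)
  generalize expNeg ((2 ^ (j + 1))⁻¹ * y) = q at hq ⊢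
  lift q to ℝ≥0 using (hq.trans_lt ENNReal.one_lt_top).ne
  norm_cast at hq ⊢
  have hqq : q * q ≤ 1 := mul_le_one' hq hq
  rw [← NNReal.coe_le_coe, NNReal.coe_mul, NNReal.coe_sub hqq, NNReal.coe_sub hq]
  push_cast
  nlinarith [sq_nonneg ((q : ℝ) - 1)]

lemma tendsto_dyadicQuotient (y : ℝ≥0∞) :
    Tendsto (fun j => dyadicQuotient j y) atTop (𝓝 y) := by
  induction y with
  | top =>
    have h : (fun j => dyadicQuotient j ∞) = fun j => 2 ^ j := by
      funext j
      simp [dyadicQuotient, ENNReal.mul_top]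
    rw [h]
    exact ENNReal.tendsto_pow_atTop_nhds_top_iff.2 (by norm_num)
  | coe x =>
    have h : (fun j => dyadicQuotient j x) = fun j => ENNReal.ofReal
        (((2 ^ j)⁻¹ : ℝ)⁻¹ * (1 - Real.exp (-((2 ^ j)⁻¹ * (x : ℝ))))) := by
      funext j
      have h1 : ((2 ^ j)⁻¹ : ℝ≥0∞) * x = (((2 ^ j)⁻¹ * x : ℝ≥0) : ℝ≥0∞) := by
        rw [ENNReal.coe_mul, ENNReal.coe_inv (by positivity)]
        simp
      rw [dyadicQuotient, h1, ← ofReal_one_sub_exp_neg, ENNReal.ofReal_mul (by positivity)]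
      congr 1
      · rw [inv_inv, ENNReal.ofReal_pow (by norm_num)]
        simp
    rw [h, ← ENNReal.ofReal_coe_nnreal]
    refine (ENNReal.continuous_ofReal.tendsto _).comp ?_
    have hd : HasDerivAt (fun s : ℝ => -Real.exp (-(s * x))) (x : ℝ) 0 := by
      have := (((hasDerivAt_id (0 : ℝ)).mul_const (x : ℝ)).neg.exp).neg
      exact this.congr_deriv (by simp)
    have ht := hasDerivAt_iff_tendsto_slope_zero.1 hd
    have hs : Tendsto (fun j : ℕ => ((2 ^ j)⁻¹ : ℝ)) atTop (𝓝[≠] 0) := by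
      refine tendsto_nhdsWithin_iff.2 ⟨?_, Eventually.of_forall fun j => by
        simp⟩
      simpa using tendsto_pow_atTop_nhds_zero_of_lt_one (r := (2⁻¹ : ℝ)) (by norm_num) (by norm_num)
    refine (ht.comp hs).congr fun j => ?_
    simp [add_comm, sub_eq_add_neg]

lemma dyadicQuotient_le (j : ℕ) (y : ℝ≥0∞) : dyadicQuotient j y ≤ y :=
  (monotone_dyadicQuotient y).ge_of_tendsto (tendsto_dyadicQuotient y) j

lemma tendsto_lintegral_dyadicQuotient {β : Type*} [MeasurableSpace β] (ν : Measure β)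
    {w g : β → ℝ≥0∞} (hw : Measurable w) (hg : Measurable g) :
    Tendsto (fun j => ∫⁻ b, w b * dyadicQuotient j (g b) ∂ν) atTop (𝓝 (∫⁻ b, w b * g b ∂ν)) := by
  refine lintegral_tendsto_of_tendsto_of_monotone
    (fun j => (hw.mul ((measurable_dyadicQuotient j).comp hg)).aemeasurable)
    (Eventually.of_forall fun b i j hij => ?_) (Eventually.of_forall fun b => ?_)
  · exact mul_le_mul_right (monotone_dyadicQuotient _ hij) _
  -- Multiplication on `[0, ∞]` is discontinuous at `(0, ∞)`, so zero factors are treated apart.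
  · by_cases hw0 : w b = 0
    · simp [hw0]
    · by_cases hg0 : g b = 0
      · have h0 : ∀ j, dyadicQuotient j 0 = 0 := fun j => by simp [dyadicQuotient]
        simp [h0, hg0]
      · exact ENNReal.Tendsto.mul tendsto_const_nhds (Or.inl hw0) (tendsto_dyadicQuotient _)
          (Or.inl hg0)

end NegBin

namespace NegBin

/-! ### Uniqueness of Laplace transforms, and finite product measures -/

open Filter Topology

section LaplaceUniqueness

open BoundedContinuousFunction

/-- The function `t ↦ exp (-t)` on `[0, ∞)`. -/
noncomputable def expNegBCF : ℝ≥0 →ᵇ ℝ :=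
  BoundedContinuousFunction.ofNormedAddCommGroup (fun t : ℝ≥0 => Real.exp (-(t : ℝ)))
    (by fun_prop) 1 (fun t => by
      rw [Real.norm_eq_abs, abs_of_pos (Real.exp_pos _), Real.exp_le_one_iff]
      simp)

lemma expNegBCF_apply (t : ℝ≥0) : expNegBCF t = Real.exp (-(t : ℝ)) := rfl

/-- The hypothesis fixes the integrals of the powers of `e^{-t}`, hence of all its polynomials.
These form a point-separating subalgebra of the bounded continuous functions, which determines a
finite measure on a Polish space. -/
lemma ext_of_lintegral_exp_nnreal {P P' : Measure ℝ≥0} [IsFiniteMeasure P] [IsFiniteMeasure P']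
    (h : ∀ k : ℕ, ∫⁻ t, ENNReal.ofReal (Real.exp (-(k * (t : ℝ)))) ∂P =
      ∫⁻ t, ENNReal.ofReal (Real.exp (-(k * (t : ℝ)))) ∂P') : P = P' := by
  let A : StarSubalgebra ℝ (ℝ≥0 →ᵇ ℝ) :=
    { Algebra.adjoin ℝ {expNegBCF} with
      star_mem' := fun {a} ha => by
        have : star a = a := by ext x; simp
        rw [this]; exact ha }
  have hmem : ∀ g, g ∈ A ↔ g ∈ Algebra.adjoin ℝ {expNegBCF} := fun g => Iff.rfl
  refine ext_of_forall_mem_subalgebra_integral_eq_of_polish (𝕜 := ℝ) (A := A) ?_ ?_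
  · intro x y hxy
    refine ⟨fun t => Real.exp (-(t : ℝ)), ⟨⟨fun t => Real.exp (-(t : ℝ)), by fun_prop⟩,
      ⟨expNegBCF, Algebra.subset_adjoin rfl, rfl⟩, rfl⟩, fun hh => hxy ?_⟩
    have := Real.exp_injective hh
    exact NNReal.coe_injective (neg_injective this)
  · intro g hg
    rw [hmem, Algebra.adjoin_singleton_eq_range_aeval] at hg
    obtain ⟨p, rfl⟩ := hg
    have hpow : ∀ k : ℕ, ∫ t, (expNegBCF ^ k) t ∂P = ∫ t, (expNegBCF ^ k) t ∂P' := by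
      intro k
      have h1 : ∀ t : ℝ≥0, (expNegBCF ^ k) t = Real.exp (-(k * (t : ℝ))) := fun t => by
        rw [BoundedContinuousFunction.pow_apply, expNegBCF_apply, ← Real.exp_nat_mul, mul_neg]
      simp_rw [h1]
      rw [integral_eq_lintegral_of_nonneg_ae (Eventually.of_forall fun t => (Real.exp_pos _).le)
        (by fun_prop), integral_eq_lintegral_of_nonneg_ae
        (Eventually.of_forall fun t => (Real.exp_pos _).le) (by fun_prop), h k]
    change ∫ t, (Polynomial.aeval expNegBCF p) t ∂P = ∫ t, (Polynomial.aeval expNegBCF p) t ∂P'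
    induction p using Polynomial.induction_on' with
    | add p q hp hq =>
      simp only [map_add, BoundedContinuousFunction.coe_add, Pi.add_apply]
      rw [integral_add (BoundedContinuousFunction.integrable _ _)
        (BoundedContinuousFunction.integrable _ _), integral_add
        (BoundedContinuousFunction.integrable _ _) (BoundedContinuousFunction.integrable _ _),
        hp, hq]
    | monomial k a =>
      have h2 : ∀ t : ℝ≥0, (Polynomial.aeval expNegBCF (Polynomial.monomial k a)) t
          = a * (expNegBCF ^ k) t := fun t => by
        rw [Polynomial.aeval_monomial, Algebra.algebraMap_eq_smul_one, smul_one_mul]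
        rfl
      simp only [h2, integral_const_mul, hpow]

/-- Finite measures on `[0, ∞)` are determined by their Laplace transforms at the integers. -/
lemma ext_of_lintegral_exp {P P' : Measure ℝ} [IsFiniteMeasure P] [IsFiniteMeasure P']
    (hP : ∀ᵐ t ∂P, 0 ≤ t) (hP' : ∀ᵐ t ∂P', 0 ≤ t)
    (h : ∀ k : ℕ, ∫⁻ t, ENNReal.ofReal (Real.exp (-(k * t))) ∂P =
      ∫⁻ t, ENNReal.ofReal (Real.exp (-(k * t))) ∂P') : P = P' := by
  have hback : ∀ {M : Measure ℝ}, (∀ᵐ t ∂M, 0 ≤ t) →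
      (M.map Real.toNNReal).map ((↑) : ℝ≥0 → ℝ) = M := by
    intro M hR
    rw [Measure.map_map (by fun_prop) (by fun_prop)]
    conv_rhs => rw [← Measure.map_id (μ := M)]
    exact Measure.map_congr (hR.mono fun t ht => Real.coe_toNNReal t ht)
  have hint : ∀ {M : Measure ℝ}, (∀ᵐ t ∂M, 0 ≤ t) → ∀ k : ℕ,
      ∫⁻ t, ENNReal.ofReal (Real.exp (-(k * (t : ℝ)))) ∂(M.map Real.toNNReal) =
        ∫⁻ t, ENNReal.ofReal (Real.exp (-(k * t))) ∂M := by
    intro M hR k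
    rw [lintegral_map (by fun_prop) (by fun_prop)]
    exact lintegral_congr_ae (hR.mono fun t ht => by simp only [Real.coe_toNNReal t ht])
  rw [← hback hP, ← hback hP']
  congr 1
  exact ext_of_lintegral_exp_nnreal fun k => by rw [hint hP, hint hP', h k]

end LaplaceUniqueness

section Pi

lemma lintegral_pi_prod {n : ℕ} {E : Type*} [MeasurableSpace E] (ν : Fin n → Measure E)
    [∀ i, SigmaFinite (ν i)] (f : Fin n → E → ℝ≥0∞) (hf : ∀ i, Measurable (f i)) :
    ∫⁻ x, ∏ i, f i (x i) ∂(Measure.pi ν) = ∏ i, ∫⁻ e, f i e ∂(ν i) := by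
  induction n with
  | zero => simp
  | succ n ih =>
    rw [← ((measurePreserving_piFinSuccAbove ν 0).symm).lintegral_comp (by fun_prop)]
    simp only [MeasurableEquiv.piFinSuccAbove_symm_apply, Fin.prod_univ_succ, Fin.insertNthEquiv,
      Equiv.coe_fn_mk, Fin.insertNth_zero, Fin.cons_zero, Fin.cons_succ]
    refine (lintegral_prod_mul (hf 0).aemeasurable (g := fun y : Fin n → E =>
      ∏ i, f (Fin.succ i) (y i)) ?_).trans ?_
    · exact (Finset.measurable_prod _ fun i _ =>
        (hf _).comp (measurable_pi_apply i)).aemeasurable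
    · congr 1
      exact ih _ _ fun i => hf _

lemma pi_withDensity {n : ℕ} {E : Type*} [MeasurableSpace E] (ν : Measure E) [SigmaFinite ν]
    {f : E → ℝ≥0∞} (hf : Measurable f) [SigmaFinite (ν.withDensity f)] :
    Measure.pi (fun _ : Fin n => ν.withDensity f) =
      (Measure.pi fun _ : Fin n => ν).withDensity fun x => ∏ i, f (x i) := by
  refine Measure.pi_eq fun s hs => ?_
  rw [withDensity_apply _ (MeasurableSet.univ_pi hs), Measure.restrict_pi_pi,
    lintegral_pi_prod _ _ fun _ => hf]
  simp only [withDensity_apply _ (hs _)]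

lemma measurable_pi {n : ℕ} {A E : Type*} [MeasurableSpace A] [MeasurableSpace E]
    (κ : Kernel A E) [IsFiniteKernel κ] :
    Measurable fun a => Measure.pi fun _ : Fin n => κ a := by
  refine Measurable.measure_of_isPiSystem generateFrom_pi.symm isPiSystem_pi ?_ ?_
  · rintro _ ⟨s, hs, rfl⟩
    simp only [Measure.pi_pi]
    exact Finset.measurable_prod _ fun i _ => κ.measurable_coe (hs i (Set.mem_univ i))
  · simp only [Measure.pi_univ]
    exact Finset.measurable_prod _ fun i _ => κ.measurable_coe MeasurableSet.univ

end Pi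

end NegBin

namespace NegBin

/-! ### Joint moments from the Laplace functional -/

open Filter Topology

/-- If `s ↦ K (a + s d_s)⁻ᵐ` has difference quotients `-B_s` along `s = 2⁻ʲ`, where `d_s → D`, then
`B_s → K m a⁻⁽ᵐ⁺¹⁾ D`. -/
lemma eq_of_tendsto_dyadic_inv_pow {K a D B : ℝ≥0∞} (m : ℕ) {d b : ℕ → ℝ≥0∞} (hK : K ≠ ∞)
    (ha : 1 ≤ a) (ha' : a ≠ ∞) (hD : D ≠ ∞) (hd : ∀ j, d j ≤ D)
    (hdt : Tendsto d atTop (𝓝 D)) (hbt : Tendsto b atTop (𝓝 B))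
    (h : ∀ j, K * (a ^ m)⁻¹ = K * ((a + (2 ^ j)⁻¹ * d j) ^ m)⁻¹ + (2 ^ j)⁻¹ * b j) :
    B = K * m * (a ^ (m + 1))⁻¹ * D := by
  have hinv : ∀ {x : ℝ≥0∞} (i : ℕ), 1 ≤ x → (x ^ i)⁻¹ ≠ ∞ := fun i hx =>
    ENNReal.inv_ne_top.2 (one_le_pow₀ hx |>.trans_lt' one_pos).ne'
  have hlhs : K * (a ^ m)⁻¹ ≠ ∞ := ENNReal.mul_ne_top hK (hinv m ha)
  -- A summand of a finite quantity is finite, so the identity can be moved to `ℝ`.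
  have hsb : ∀ j, (2 ^ j)⁻¹ * b j ≠ ∞ := fun j =>
    ne_top_of_le_ne_top hlhs (by rw [h j]; exact le_add_self)
  have hb : ∀ j, b j ≠ ∞ := fun j hj => hsb j (by rw [hj]; simp [ENNReal.mul_top])
  have hdf : ∀ j, d j ≠ ∞ := fun j => ne_top_of_le_ne_top hD (hd j)
  have ha1 : 1 ≤ a.toReal := by
    have := ENNReal.toReal_mono ha' ha
    simpa using this
  have ha0 : 0 < a.toReal := by linarith
  set x : ℕ → ℝ := fun j => a.toReal + (2 ^ j)⁻¹ * (d j).toReal with hx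
  have hx0 : ∀ j, 0 < x j := fun j => by positivity
  have hreal : ∀ j, (b j).toReal = K.toReal * (d j).toReal *
      (∑ i ∈ Finset.range m, x j ^ i * a.toReal ^ (m - 1 - i)) *
        (((x j) ^ m)⁻¹ * (a.toReal ^ m)⁻¹) := by
    intro j
    have hj := congrArg ENNReal.toReal (h j)
    have hfin : K * ((a + (2 ^ j)⁻¹ * d j) ^ m)⁻¹ ≠ ∞ :=
      ENNReal.mul_ne_top hK (hinv m (ha.trans le_self_add))
    rw [ENNReal.toReal_add hfin (hsb j)] at hj
    simp only [ENNReal.toReal_mul, ENNReal.toReal_inv, ENNReal.toReal_pow] at hj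
    rw [ENNReal.toReal_add ha' (ENNReal.mul_ne_top (by simp) (hdf j))] at hj
    simp only [ENNReal.toReal_mul, ENNReal.toReal_inv, ENNReal.toReal_pow,
      ENNReal.toReal_ofNat] at hj
    -- Factoring `x^m - a^m` exhibits `x - a = 2⁻ʲ d_j`, which cancels the step in the difference
    -- quotient.
    have hg := geom_sum₂_mul (x j) a.toReal m
    have hxa : x j - a.toReal = (2 ^ j)⁻¹ * (d j).toReal := by simp [hx]
    rw [hxa] at hg
    change K.toReal * (a.toReal ^ m)⁻¹ = K.toReal * (x j ^ m)⁻¹ + _ at hj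
    have h2 : (0 : ℝ) < 2 ^ j := by positivity
    have hxm := pow_pos (hx0 j) m
    have ham := pow_pos ha0 m
    generalize (∑ i ∈ Finset.range m, x j ^ i * a.toReal ^ (m - 1 - i)) = S at hg ⊢
    have h3 : (b j).toReal = 2 ^ j * (K.toReal * (a.toReal ^ m)⁻¹ - K.toReal * (x j ^ m)⁻¹) := by
      rw [hj]; field_simp; ring
    have h4 : S * (d j).toReal = 2 ^ j * (x j ^ m - a.toReal ^ m) := by
      rw [← hg]; field_simp
    rw [h3]
    field_simp
    linear_combination (-K.toReal) * h4
  have hdr : Tendsto (fun j => (d j).toReal) atTop (𝓝 D.toReal) :=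
    (ENNReal.tendsto_toReal hD).comp hdt
  have hs : Tendsto (fun j : ℕ => ((2 ^ j)⁻¹ : ℝ)) atTop (𝓝 0) := by
    simpa using tendsto_pow_atTop_nhds_zero_of_lt_one (r := (2⁻¹ : ℝ)) (by norm_num) (by norm_num)
  have hxt : Tendsto x atTop (𝓝 a.toReal) := by
    simpa using (hs.mul hdr).const_add a.toReal
  have hlim : Tendsto (fun j => (b j).toReal) atTop (𝓝 (K.toReal * m *
      (a.toReal ^ (m + 1))⁻¹ * D.toReal)) := by
    simp_rw [hreal]
    have hsum : Tendsto (fun j => ∑ i ∈ Finset.range m, x j ^ i * a.toReal ^ (m - 1 - i)) atTop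
        (𝓝 (m * a.toReal ^ (m - 1))) := by
      rw [← geom_sum₂_self]
      exact tendsto_finsetSum _ fun i _ => (hxt.pow i).mul_const _
    have := ((hdr.const_mul K.toReal).mul hsum).mul
      (((hxt.pow m).inv₀ (pow_pos ha0 m).ne').mul_const ((a.toReal ^ m)⁻¹))
    convert this using 2
    -- The exponent `m - 1` is truncated at `m = 0`, where the sum is empty.
    cases m with
    | zero => simp
    | succ m =>
      rw [Nat.add_sub_cancel]
      field_simp
      ring
  have hBt : Tendsto b atTop (𝓝 (ENNReal.ofReal (K.toReal * m *
      (a.toReal ^ (m + 1))⁻¹ * D.toReal))) := by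
    refine ((ENNReal.continuous_ofReal.tendsto _).comp hlim).congr fun j => ?_
    exact ENNReal.ofReal_toReal (hb j)
  rw [tendsto_nhds_unique hbt hBt]
  have hend : K * m * (a ^ (m + 1))⁻¹ * D ≠ ∞ :=
    ENNReal.mul_ne_top (ENNReal.mul_ne_top (ENNReal.mul_ne_top hK (by simp)) (hinv _ ha)) hD
  rw [← ENNReal.ofReal_toReal hend]
  simp

variable {Ω : Type*} [MeasurableSpace Ω]

lemma measurable_lintegral_random {N : Ω → Measure ℝ} (hN : Measurable N) {g : ℝ → ℝ≥0∞}
    (hg : Measurable g) : Measurable fun ω => ∫⁻ x, g x ∂(N ω) :=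
  (Measure.measurable_lintegral hg).comp hN

/-- The Laplace exponent `∫ (1 - exp (-f)) dQ`. -/
noncomputable def laplaceExponent (Q : Measure ℝ) (f : ℝ → ℝ≥0) : ℝ≥0∞ :=
  ∫⁻ x, (1 - expNeg (f x)) ∂Q

lemma IsNegBinomialProcess.lintegral_expNeg {μ : Measure Ω} {N : Ω → Measure ℝ} {r : ℕ}
    {Q : Measure ℝ} (hN : IsNegBinomialProcess μ N r Q) {f : ℝ → ℝ≥0} (hf : Measurable f) :
    ∫⁻ ω, expNeg (∫⁻ x, f x ∂(N ω)) ∂μ = ((1 + laplaceExponent Q f) ^ r)⁻¹ := by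
  have := hN.laplace f hf
  simp only [ofReal_one_sub_exp_neg] at this
  exact this

/-- Joint moments of a negative binomial process, exponentially tilted. -/
lemma IsNegBinomialProcess.lintegral_prod_mul_expNeg {μ : Measure Ω} {N : Ω → Measure ℝ} {r : ℕ}
    {Q : Measure ℝ} (hN : IsNegBinomialProcess μ N r Q) {ι : Type*}
    {h : ι → ℝ → ℝ≥0} (hm : ∀ i, Measurable (h i)) (hfin : ∀ i, ∫⁻ x, h i x ∂Q ≠ ∞)
    (hdisj : ∀ i j, i ≠ j → ∀ x, h i x = 0 ∨ h j x = 0) (s : Finset ι) :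
    ∀ {f : ℝ → ℝ≥0}, Measurable f → laplaceExponent Q f ≠ ∞ →
    ∫⁻ ω, (∏ i ∈ s, ∫⁻ x, h i x ∂(N ω)) * expNeg (∫⁻ x, f x ∂(N ω)) ∂μ =
      r.ascFactorial s.card * ((1 + laplaceExponent Q f) ^ (r + s.card))⁻¹ *
        ∏ i ∈ s, ∫⁻ x, h i x * expNeg (f x) ∂Q := by
  classical
  induction s using Finset.induction_on with
  | empty =>
    intro f hf _
    simp [hN.lintegral_expNeg hf]
  | insert a s has ih =>
    intro f hf hL
    -- The new factor `N(h_a)` arises by differentiating in `f` along `h_a`. The induction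
    -- hypothesis is therefore needed at the perturbed `fs j` too, which is why `f` is quantified
    -- after `s`.
    set fs : ℕ → ℝ → ℝ≥0 := fun j x => f x + (2 ^ j)⁻¹ * h a x with hfs
    have hfsm : ∀ j, Measurable (fs j) := fun j => hf.add ((hm a).const_mul _)
    have hcoe : ∀ j x, (fs j x : ℝ≥0∞) = f x + (2 ^ j)⁻¹ * h a x := fun j x => by
      simp [hfs, ENNReal.coe_inv]
    have hNfs : ∀ j ω, ∫⁻ x, fs j x ∂(N ω) =
        ∫⁻ x, f x ∂(N ω) + (2 ^ j)⁻¹ * ∫⁻ x, h a x ∂(N ω) := fun j ω => by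
      simp_rw [hcoe]
      rw [lintegral_add_left (by fun_prop), lintegral_const_mul _ (by fun_prop)]
    have hef : Measurable fun x => expNeg (f x) := measurable_expNeg.comp (by fun_prop)
    have hha : Measurable fun x => (h a x : ℝ≥0∞) := (hm a).coe_nnreal_ennreal
    have hdm : ∀ j, Measurable fun x => expNeg (f x) * dyadicQuotient j (h a x) := fun j =>
      hef.mul ((measurable_dyadicQuotient j).comp hha)
    set D : ℕ → ℝ≥0∞ := fun j => ∫⁻ x, expNeg (f x) * dyadicQuotient j (h a x) ∂Q with hDdef
    have hLfs : ∀ j, laplaceExponent Q (fs j) = laplaceExponent Q f + (2 ^ j)⁻¹ * D j := by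
      intro j
      simp only [hDdef, laplaceExponent]
      rw [← lintegral_const_mul _ (hdm j), ← lintegral_add_right _ ((hdm j).const_mul _)]
      refine lintegral_congr fun x => ?_
      rw [hcoe]
      have h1 := expNeg_eq_add j (f x) (h a x)
      have h2 := expNeg_le_one (f x)
      set p := expNeg (f x + (2 ^ j)⁻¹ * h a x)
      set q := (2 ^ j)⁻¹ * (expNeg (f x) * dyadicQuotient j (h a x))
      rw [h1] at h2 ⊢
      have hq : q ≠ ∞ := ((le_add_self.trans h2).trans_lt ENNReal.one_lt_top).ne
      rw [tsub_add_eq_tsub_tsub, tsub_add_cancel_of_le]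
      exact ENNReal.le_sub_of_add_le_left
        ((le_self_add.trans h2).trans_lt ENNReal.one_lt_top).ne h2
    have hDle : ∀ j, D j ≤ ∫⁻ x, expNeg (f x) * h a x ∂Q := fun j =>
      lintegral_mono fun x => mul_le_mul_right (dyadicQuotient_le _ _) _
    have hDfin : ∫⁻ x, expNeg (f x) * h a x ∂Q ≠ ∞ :=
      ne_top_of_le_ne_top (hfin a) (lintegral_mono fun x => mul_le_of_le_one_left' (expNeg_le_one _))
    have hLfin : ∀ j, laplaceExponent Q (fs j) ≠ ∞ := fun j => by
      rw [hLfs]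
      exact ENNReal.add_ne_top.2 ⟨hL, ENNReal.mul_ne_top (by simp)
        (ne_top_of_le_ne_top hDfin (hDle j))⟩
    -- Disjoint supports enter here: on the support of `h i` the perturbation vanishes, so only the
    -- power of the Laplace exponent is differentiated.
    have hprod : ∀ j, ∏ i ∈ s, ∫⁻ x, h i x * expNeg (fs j x) ∂Q =
        ∏ i ∈ s, ∫⁻ x, h i x * expNeg (f x) ∂Q := by
      intro j
      refine Finset.prod_congr rfl fun i hi => lintegral_congr fun x => ?_
      rcases hdisj i a (fun hia => has (hia ▸ hi)) x with h0 | h0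
      · simp [h0]
      · rw [hcoe, h0]; simp
    set P := ∏ i ∈ s, ∫⁻ x, h i x * expNeg (f x) ∂Q with hP
    have hPfin : P ≠ ∞ := ENNReal.prod_ne_top fun i _ => ne_top_of_le_ne_top (hfin i)
      (lintegral_mono fun x => mul_le_of_le_one_right' (expNeg_le_one _))
    set W : Ω → ℝ≥0∞ := fun ω => ∏ i ∈ s, ∫⁻ x, h i x ∂(N ω) with hW
    have hWm : Measurable W := Finset.measurable_prod _ fun i _ =>
      measurable_lintegral_random hN.measurable (hm i).coe_nnreal_ennreal
    have hEm : Measurable fun ω => expNeg (∫⁻ x, f x ∂(N ω)) := measurable_expNeg.comp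
      (measurable_lintegral_random hN.measurable hf.coe_nnreal_ennreal)
    have hAm : Measurable fun ω => ∫⁻ x, h a x ∂(N ω) :=
      measurable_lintegral_random hN.measurable hha
    have hbm : ∀ j, Measurable fun ω => W ω * expNeg (∫⁻ x, f x ∂(N ω)) *
        dyadicQuotient j (∫⁻ x, h a x ∂(N ω)) := fun j =>
      (hWm.mul hEm).mul ((measurable_dyadicQuotient j).comp hAm)
    set b : ℕ → ℝ≥0∞ := fun j => ∫⁻ ω, (W ω * expNeg (∫⁻ x, f x ∂(N ω))) *
      dyadicQuotient j (∫⁻ x, h a x ∂(N ω)) ∂μ with hb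
    have hkey := eq_of_tendsto_dyadic_inv_pow (K := r.ascFactorial s.card * P)
      (a := 1 + laplaceExponent Q f) (r + s.card)
      (ENNReal.mul_ne_top (by simp) hPfin) le_self_add (ENNReal.add_ne_top.2 ⟨by simp, hL⟩)
      hDfin hDle (tendsto_lintegral_dyadicQuotient Q hef hha)
      (tendsto_lintegral_dyadicQuotient μ (hWm.mul hEm) hAm) ?_
    · have hlhs : ∀ ω, (∏ i ∈ insert a s, ∫⁻ x, h i x ∂(N ω)) * expNeg (∫⁻ x, f x ∂(N ω)) =
          W ω * expNeg (∫⁻ x, f x ∂(N ω)) * ∫⁻ x, h a x ∂(N ω) := fun ω => by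
        rw [Finset.prod_insert has]; ring
      simp_rw [hlhs]
      refine hkey.trans ?_
      rw [Finset.prod_insert has, Finset.card_insert_of_notMem has, Nat.ascFactorial_succ]
      simp_rw [mul_comm (expNeg _)]
      push_cast
      rw [add_assoc]
      ring
    · intro j
      have e1 := ih hf hL
      have e2 := ih (hfsm j) (hLfin j)
      rw [hprod, hLfs] at e2
      rw [mul_right_comm] at e1 e2
      rw [add_assoc, ← e1, ← e2]
      change _ = _ + (2 ^ j)⁻¹ * ∫⁻ ω, W ω * expNeg (∫⁻ x, f x ∂(N ω)) *
        dyadicQuotient j (∫⁻ x, h a x ∂(N ω)) ∂μ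
      rw [← lintegral_const_mul _ (hbm j), ← lintegral_add_right _ ((hbm j).const_mul _)]
      refine lintegral_congr fun ω => ?_
      rw [hNfs]
      nth_rewrite 1 [expNeg_eq_add j (∫⁻ x, f x ∂(N ω)) (∫⁻ x, h a x ∂(N ω))]
      simp only [hW]
      ring

end NegBin

namespace NegBin

/-! ### The sum of the points and its law weighted by moments -/

open Filter Topology

/-- The weighted measure `x M(dx)`. -/
noncomputable def sizeBiased (M : Measure ℝ) : Measure ℝ :=
  M.withDensity fun x => ENNReal.ofReal x

lemma sizeBiased_apply (M : Measure ℝ) {A : Set ℝ} (hA : MeasurableSet A) :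
    sizeBiased M A = ∫⁻ x in A, ENNReal.ofReal x ∂M := withDensity_apply _ hA

lemma sizeBiased_univ (M : Measure ℝ) : sizeBiased M Set.univ = totalSum M := by
  rw [sizeBiased_apply _ MeasurableSet.univ, Measure.restrict_univ, totalSum]

lemma measurable_totalSum : Measurable totalSum :=
  Measure.measurable_lintegral ENNReal.measurable_ofReal

lemma measurable_sizeBiased : Measurable sizeBiased := by
  refine Measure.measurable_of_measurable_coe _ fun A hA => ?_
  have h : (fun M => sizeBiased M A) =
      fun M => ∫⁻ x, A.indicator (fun x => ENNReal.ofReal x) x ∂M := by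
    funext M
    rw [sizeBiased_apply _ hA, lintegral_indicator hA]
  rw [h]
  exact Measure.measurable_lintegral (ENNReal.measurable_ofReal.indicator hA)

lemma one_sub_expNeg_le (y : ℝ≥0∞) : 1 - expNeg y ≤ y := by
  simpa [dyadicQuotient] using dyadicQuotient_le 0 y

lemma IsPointMeasure.compl_Ioo {M : Measure ℝ} (hM : IsPointMeasure M) :
    M (Set.Ioo 0 1)ᶜ = 0 := by
  obtain ⟨I, x, hx, rfl⟩ := hM.atomic
  rw [Measure.sum_apply _ measurableSet_Ioo.compl, ENNReal.tsum_eq_zero]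
  intro i
  rw [Measure.dirac_apply' _ measurableSet_Ioo.compl]
  simp [(hx i).1, (hx i).2]

lemma laplaceExponent_mul_le (Q : Measure ℝ) (θ : ℝ≥0) :
    laplaceExponent Q (fun x => θ * x.toNNReal) ≤ θ * totalSum Q := by
  rw [totalSum, ← lintegral_const_mul _ ENNReal.measurable_ofReal]
  refine lintegral_mono fun x => (one_sub_expNeg_le _).trans ?_
  simp [ENNReal.ofReal]

lemma laplaceExponent_mul_ne_top {Q : Measure ℝ} (hQ : totalSum Q ≠ ∞) (θ : ℝ≥0) :
    laplaceExponent Q (fun x => θ * x.toNNReal) ≠ ∞ :=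
  ne_top_of_le_ne_top (ENNReal.mul_ne_top (by simp) hQ) (laplaceExponent_mul_le Q θ)

lemma lintegral_mul_toNNReal (M : Measure ℝ) (θ : ℝ≥0) :
    ∫⁻ x, ((θ * x.toNNReal : ℝ≥0) : ℝ≥0∞) ∂M = θ * totalSum M := by
  simp only [ENNReal.coe_mul]
  rw [lintegral_const_mul _ (by fun_prop)]
  rfl

variable {Ω : Type*} [MeasurableSpace Ω]

lemma IsNegBinomialProcess.lintegral_expNeg_totalSum {μ : Measure Ω} {N : Ω → Measure ℝ} {r : ℕ}
    {Q : Measure ℝ} (hN : IsNegBinomialProcess μ N r Q) (θ : ℝ≥0) :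
    ∫⁻ ω, expNeg (θ * totalSum (N ω)) ∂μ =
      ((1 + laplaceExponent Q (fun x => θ * x.toNNReal)) ^ r)⁻¹ := by
  rw [← hN.lintegral_expNeg (by fun_prop)]
  simp_rw [lintegral_mul_toNNReal]

/-- The sum of the points is almost surely finite. -/
lemma IsNegBinomialProcess.totalSum_lt_top {μ : Measure Ω} [IsProbabilityMeasure μ]
    {N : Ω → Measure ℝ} {r : ℕ} {Q : Measure ℝ} (hN : IsNegBinomialProcess μ N r Q)
    (hQ : totalSum Q ≠ ∞) : ∀ᵐ ω ∂μ, totalSum (N ω) < ∞ := by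
  have hmeas : MeasurableSet {ω | totalSum (N ω) < ∞} :=
    (measurable_totalSum.comp hN.measurable) measurableSet_Iio
  refine (mem_ae_iff_prob_eq_one hmeas).2 (le_antisymm prob_le_one ?_)
  -- `P(T < ∞) ≥ E e^{-θT} ≥ (1 + θ T(Q))^{-r}` with `θ = 2⁻ʲ`, which tends to `0`.
  have hbound : ∀ j : ℕ, ((1 + (2 ^ j)⁻¹ * totalSum Q) ^ r)⁻¹ ≤ μ {ω | totalSum (N ω) < ∞} := by
    intro j
    have h1 := hN.lintegral_expNeg_totalSum ((2 ^ j)⁻¹)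
    have h2 := laplaceExponent_mul_le Q ((2 ^ j)⁻¹)
    have hc : (((2 ^ j)⁻¹ : ℝ≥0) : ℝ≥0∞) = (2 ^ j)⁻¹ := by simp [ENNReal.coe_inv]
    rw [hc] at h1 h2
    calc ((1 + (2 ^ j)⁻¹ * totalSum Q) ^ r)⁻¹
        ≤ ∫⁻ ω, expNeg ((2 ^ j)⁻¹ * totalSum (N ω)) ∂μ := by
          rw [h1]
          gcongr
      _ ≤ ∫⁻ ω, {ω | totalSum (N ω) < ∞}.indicator 1 ω ∂μ := by
          refine lintegral_mono fun ω => ?_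
          by_cases hω : totalSum (N ω) < ∞
          · simp [hω, expNeg_le_one]
          · simp [not_lt_top_iff.1 hω, ENNReal.mul_top]
      _ = _ := lintegral_indicator_one hmeas
  have hlim : Tendsto (fun j : ℕ => ((1 + (2 ^ j)⁻¹ * totalSum Q) ^ r)⁻¹) atTop (𝓝 1) := by
    have hs : Tendsto (fun j : ℕ => ((2 ^ j)⁻¹ : ℝ≥0∞)) atTop (𝓝 0) := by
      simp [ENNReal.inv_pow]
    have h1 : Tendsto (fun j : ℕ => 1 + (2 ^ j)⁻¹ * totalSum Q) atTop (𝓝 1) := by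
      simpa using (ENNReal.Tendsto.mul_const hs (Or.inr hQ)).const_add 1
    simpa using ((ENNReal.continuous_pow r).tendsto _ |>.comp h1).inv
  exact le_of_tendsto' hlim hbound

section Palm

variable {Ω' : Type*} [MeasurableSpace Ω'] {n : ℕ}

/-- For disjoint `B i`, the measure `E[∏ ∫_{B i} x N(dx); T ∈ dt]` in terms of the sum `T'` of a
negative binomial process of higher index. -/
lemma IsNegBinomialProcess.map_withDensity_eq {μ : Measure Ω} [IsProbabilityMeasure μ]
    {N : Ω → Measure ℝ} {r : ℕ} {Q : Measure ℝ} (hN : IsNegBinomialProcess μ N r Q)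
    {μ' : Measure Ω'} [IsProbabilityMeasure μ'] {N' : Ω' → Measure ℝ}
    (hN' : IsNegBinomialProcess μ' N' (r + n) Q) (hQ : totalSum Q ≠ ∞) (hpos : ∀ᵐ x ∂Q, 0 < x)
    {B : Fin n → Set ℝ} (hB : ∀ i, MeasurableSet (B i))
    (hdisj : ∀ i j, i ≠ j → Disjoint (B i) (B j)) :
    (μ.withDensity fun ω => ∏ i, sizeBiased (N ω) (B i)).map
        (fun ω => (totalSum (N ω)).toReal) =
      (r.ascFactorial n : ℝ≥0∞) • ((Measure.pi fun i => (sizeBiased Q).restrict (B i)).prod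
        (μ'.map fun ω => (totalSum (N' ω)).toReal)).map fun p => p.2 + ∑ i, p.1 i := by
  have hfinQ : IsFiniteMeasure (sizeBiased Q) := ⟨by rw [sizeBiased_univ]; exact hQ.lt_top⟩
  have hT : Measurable fun ω => (totalSum (N ω)).toReal :=
    (measurable_totalSum.comp hN.measurable).ennreal_toReal
  have hT' : Measurable fun ω => (totalSum (N' ω)).toReal :=
    (measurable_totalSum.comp hN'.measurable).ennreal_toReal
  have hBm : ∀ i, Measurable fun ω => sizeBiased (N ω) (B i) := fun i =>
    (Measure.measurable_coe (hB i)).comp (measurable_sizeBiased.comp hN.measurable)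
  have hWm : Measurable fun ω => ∏ i, sizeBiased (N ω) (B i) :=
    Finset.measurable_prod _ fun i _ => hBm i
  have hexp : ∀ (k : ℕ) {y : ℝ≥0∞}, y < ∞ →
      ENNReal.ofReal (Real.exp (-(k * y.toReal))) = expNeg ((k : ℝ≥0) * y) := by
    intro k y hy
    rw [← expNeg_ofReal (by positivity), ENNReal.ofReal_mul (by positivity),
      ENNReal.ofReal_toReal hy.ne]
    simp
  have hleft : ∀ k : ℕ, ∫⁻ t, ENNReal.ofReal (Real.exp (-(k * t)))
      ∂((μ.withDensity fun ω => ∏ i, sizeBiased (N ω) (B i)).map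
        (fun ω => (totalSum (N ω)).toReal)) =
      r.ascFactorial n * ((1 + laplaceExponent Q fun x => (k : ℝ≥0) * x.toNNReal) ^ (r + n))⁻¹ *
        ∏ i, ∫⁻ x in B i, ENNReal.ofReal (Real.exp (-(k * x))) ∂(sizeBiased Q) := by
    intro k
    rw [lintegral_map (by fun_prop) hT, lintegral_withDensity_eq_lintegral_mul _ hWm (by fun_prop)]
    set h : Fin n → ℝ → ℝ≥0 := fun i => (B i).indicator Real.toNNReal with hh
    have hint : ∀ (i : Fin n) (M : Measure ℝ), ∫⁻ x, h i x ∂M = sizeBiased M (B i) := by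
      intro i M
      rw [sizeBiased_apply _ (hB i), ← lintegral_indicator (hB i)]
      refine lintegral_congr fun x => ?_
      by_cases hx : x ∈ B i <;> simp [hh, hx, ENNReal.ofReal]
    have key := hN.lintegral_prod_mul_expNeg (h := h)
      (fun i => measurable_real_toNNReal.indicator (hB i))
      (fun i => by rw [hint]; exact measure_ne_top _ _)
      (fun i j hij x => by
        by_cases hx : x ∈ B i
        · exact Or.inr (Set.indicator_of_notMem (Set.disjoint_left.1 (hdisj i j hij) hx) _)
        · exact Or.inl (Set.indicator_of_notMem hx _))
      Finset.univ (f := fun x => (k : ℝ≥0) * x.toNNReal) (by fun_prop)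
      (laplaceExponent_mul_ne_top hQ k)
    simp only [hint, lintegral_mul_toNNReal, Finset.card_univ, Fintype.card_fin] at key
    refine Eq.trans ?_ (key.trans ?_)
    · refine lintegral_congr_ae ((hN.totalSum_lt_top hQ).mono fun ω hω => ?_)
      simp only [Pi.mul_apply]
      rw [hexp k hω]
    · congr 1
      refine Finset.prod_congr rfl fun i _ => ?_
      rw [sizeBiased, restrict_withDensity (hB i), lintegral_withDensity_eq_lintegral_mul _
        ENNReal.measurable_ofReal (by fun_prop), ← lintegral_indicator (hB i)]
      refine lintegral_congr_ae (hpos.mono fun x hx => ?_)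
      by_cases hxB : x ∈ B i
      · simp only [hh, hxB, Set.indicator_of_mem, Pi.mul_apply]
        rw [← expNeg_ofReal (by positivity), ENNReal.ofReal_mul (by positivity)]
        simp [ENNReal.ofReal]
      · simp [hh, hxB]
  have hright : ∀ k : ℕ, ∫⁻ t, ENNReal.ofReal (Real.exp (-(k * t)))
      ∂((r.ascFactorial n : ℝ≥0∞) • ((Measure.pi fun i => (sizeBiased Q).restrict (B i)).prod
        (μ'.map fun ω => (totalSum (N' ω)).toReal)).map fun p => p.2 + ∑ i, p.1 i) =
      r.ascFactorial n * ((1 + laplaceExponent Q fun x => (k : ℝ≥0) * x.toNNReal) ^ (r + n))⁻¹ *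
        ∏ i, ∫⁻ x in B i, ENNReal.ofReal (Real.exp (-(k * x))) ∂(sizeBiased Q) := by
    intro k
    have hsplit : ∀ p : (Fin n → ℝ) × ℝ, ENNReal.ofReal (Real.exp (-(k * (p.2 + ∑ i, p.1 i)))) =
        (∏ i, ENNReal.ofReal (Real.exp (-(k * p.1 i)))) *
          ENNReal.ofReal (Real.exp (-(k * p.2))) := by
      intro p
      rw [← ENNReal.ofReal_prod_of_nonneg fun i _ => (Real.exp_pos _).le, ← Real.exp_sum,
        ← ENNReal.ofReal_mul (Real.exp_pos _).le, ← Real.exp_add]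
      congr 2
      rw [Finset.sum_neg_distrib, ← Finset.mul_sum]
      ring
    rw [lintegral_smul_measure, lintegral_map (by fun_prop) (by fun_prop)]
    simp_rw [hsplit]
    rw [lintegral_prod_mul
      (f := fun x : Fin n → ℝ => ∏ i, ENNReal.ofReal (Real.exp (-(k * x i))))
      (g := fun s => ENNReal.ofReal (Real.exp (-(k * s))))
      (Measurable.aemeasurable (by fun_prop)) (by fun_prop),
      lintegral_pi_prod _
      (fun _ x => ENNReal.ofReal (Real.exp (-(k * x)))) (fun i => by fun_prop),
      lintegral_map (by fun_prop) hT', ← hN'.lintegral_expNeg_totalSum, smul_eq_mul,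
      mul_comm (∏ i, _), mul_assoc]
    congr 2
    exact lintegral_congr_ae ((hN'.totalSum_lt_top hQ).mono fun ω hω => hexp k hω)
  have hsmulfin : IsFiniteMeasure ((r.ascFactorial n : ℝ≥0∞) •
      ((Measure.pi fun i => (sizeBiased Q).restrict (B i)).prod
        (μ'.map fun ω => (totalSum (N' ω)).toReal)).map fun p => p.2 + ∑ i, p.1 i) :=
    Measure.smul_finite _ (by simp)
  have hleftfin : IsFiniteMeasure ((μ.withDensity fun ω => ∏ i, sizeBiased (N ω) (B i)).map
        (fun ω => (totalSum (N ω)).toReal)) := by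
    refine ⟨?_⟩
    -- The transform at `k = 0` is the total mass, so the left measure inherits finiteness from the
    -- right one.
    have h0 := (hleft 0).trans (hright 0).symm
    simp only [CharP.cast_eq_zero, zero_mul, neg_zero, Real.exp_zero, ENNReal.ofReal_one,
      lintegral_const, one_mul] at h0
    rw [h0]
    exact measure_lt_top _ _
  refine ext_of_lintegral_exp ?_ ?_ fun k => (hleft k).trans (hright k).symm
  · rw [ae_map_iff hT.aemeasurable measurableSet_Ici]
    exact Eventually.of_forall fun ω => ENNReal.toReal_nonneg
  · refine Measure.ae_smul_measure ?_ _
    rw [ae_map_iff (by fun_prop) measurableSet_Ici]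
    have h1 : ∀ᵐ p ∂((Measure.pi fun i => (sizeBiased Q).restrict (B i)).prod
        (μ'.map fun ω => (totalSum (N' ω)).toReal)), ∀ i, 0 < p.1 i := by
      refine Measure.quasiMeasurePreserving_fst.ae (p := fun x : Fin n → ℝ => ∀ i, 0 < x i) ?_
      refine eventually_all.2 fun i => ?_
      refine (Measure.quasiMeasurePreserving_eval (fun i => (sizeBiased Q).restrict (B i)) i).ae
        (p := fun s : ℝ => 0 < s) (ae_restrict_of_ae ?_)
      exact (withDensity_absolutelyContinuous _ _).ae_le hpos
    have h2 : ∀ᵐ p ∂((Measure.pi fun i => (sizeBiased Q).restrict (B i)).prod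
        (μ'.map fun ω => (totalSum (N' ω)).toReal)), 0 ≤ p.2 := by
      refine Measure.quasiMeasurePreserving_snd.ae (p := fun s : ℝ => 0 ≤ s) ?_
      rw [ae_map_iff hT'.aemeasurable measurableSet_Ici]
      exact Eventually.of_forall fun ω => ENNReal.toReal_nonneg
    filter_upwards [h1, h2] with p hp1 hp2
    exact add_nonneg hp2 (Finset.sum_nonneg fun i _ => (hp1 i).le)

end Palm

end NegBin

namespace NegBin

/-! ### The joint law of the size-biased picks -/

open Filter Topology

/-- The law of a size-biased pick, as a kernel: `M ↦ T(M)⁻¹ x M(dx)`. -/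
noncomputable def pickKernel : Kernel (Measure ℝ) ℝ where
  toFun M := (totalSum M)⁻¹ • sizeBiased M
  measurable' := by
    refine Measure.measurable_of_measurable_coe _ fun A hA => ?_
    simp only [Measure.smul_apply, smul_eq_mul]
    exact measurable_totalSum.inv.mul ((Measure.measurable_coe hA).comp measurable_sizeBiased)

lemma pickKernel_apply (M : Measure ℝ) : pickKernel M = (totalSum M)⁻¹ • sizeBiased M := rfl

instance : IsFiniteKernel pickKernel where
  exists_univ_le := ⟨1, ENNReal.one_lt_top, fun M => by
    rw [pickKernel_apply, Measure.smul_apply, sizeBiased_univ, smul_eq_mul]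
    exact ENNReal.inv_mul_le_one _⟩

lemma smul_pickKernel {M : Measure ℝ} (hM : totalSum M < ∞) :
    ENNReal.ofReal (totalSum M).toReal • pickKernel M = sizeBiased M := by
  rw [ENNReal.ofReal_toReal hM.ne, pickKernel_apply, smul_smul]
  -- At `T = 0` the factor `T⁻¹ = ∞` does not cancel, but then `x M(dx)` is the zero measure.
  by_cases h0 : totalSum M = 0
  · have : sizeBiased M = 0 := by rw [← Measure.measure_univ_eq_zero, sizeBiased_univ, h0]
    simp [this]
  · rw [ENNReal.mul_inv_cancel h0 hM.ne, one_smul]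

/-- The density, with respect to `x M(dx)`, of the next size-biased pick after `y`, when
`T(M) = t`. -/
noncomputable def pickWeight {k : ℕ} (y : Fin k → ℝ) (x t : ℝ) : ℝ≥0∞ :=
  {x | ∀ l, x ≠ y l}.indicator (fun _ => ENNReal.ofReal (t - ∑ l, y l)⁻¹) x

lemma measurableSet_ne_fin {k : ℕ} (y : Fin k → ℝ) : MeasurableSet {x | ∀ l, x ≠ y l} := by
  rw [Set.ofPred_forall]
  exact MeasurableSet.iInter fun l => (measurableSet_singleton (y l)).compl

lemma measurable_pickWeight {k : ℕ} {A : Type*} [MeasurableSpace A] {y : A → Fin k → ℝ}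
    {x t : A → ℝ} (hy : Measurable y) (hx : Measurable x) (ht : Measurable t) :
    Measurable fun a => pickWeight (y a) (x a) (t a) := by
  have h : (fun a => pickWeight (y a) (x a) (t a)) = {a | ∀ l, x a ≠ y a l}.indicator
      (fun a => ENNReal.ofReal (t a - ∑ l, y a l)⁻¹) := by
    funext a
    simp [pickWeight, Set.indicator_apply]
  rw [h]
  refine Measurable.indicator (by fun_prop) ?_
  rw [Set.ofPred_forall]
  exact MeasurableSet.iInter fun l => (measurableSet_eq_fun hx (by fun_prop)).compl

/-- Rewriting with respect to the normalised `pickKernel` puts every pick on one finite reference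
kernel that does not involve the past; the past enters only through the density. -/
lemma nextPickLaw_eq {M : Measure ℝ} (hM : totalSum M < ∞) (hpos : ∀ᵐ x ∂M, 0 < x) {k : ℕ}
    (y : Fin k → ℝ) :
    nextPickLaw M y = (pickKernel M).withDensity fun x =>
      ENNReal.ofReal (totalSum M).toReal * pickWeight y x (totalSum M).toReal := by
  have hw : Measurable fun x => pickWeight y x (totalSum M).toReal :=
    measurable_pickWeight measurable_const measurable_id measurable_const
  have h1 : (pickKernel M).withDensity (fun x =>
      ENNReal.ofReal (totalSum M).toReal * pickWeight y x (totalSum M).toReal) =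
      (sizeBiased M).withDensity fun x => pickWeight y x (totalSum M).toReal := by
    rw [← smul_pickKernel hM, withDensity_smul_measure, ← withDensity_smul _ hw]
    rfl
  rw [h1, sizeBiased, ← withDensity_mul _ ENNReal.measurable_ofReal hw, nextPickLaw,
    ← withDensity_indicator (measurableSet_ne_fin y)]
  refine withDensity_congr_ae (hpos.mono fun x hx => ?_)
  simp only [Pi.mul_apply, pickWeight, Set.indicator_apply]
  split_ifs
  · rw [div_eq_mul_inv, ENNReal.ofReal_mul hx.le]
  · simp

/-- The law of the next size-biased pick as a kernel from point measures and past picks. -/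
noncomputable def nextPickKernel (k : ℕ) : Kernel (Measure ℝ × (Fin k → ℝ)) ℝ :=
  Kernel.withDensity (pickKernel.comap Prod.fst measurable_fst) fun p x =>
    ENNReal.ofReal (totalSum p.1).toReal * pickWeight p.2 x (totalSum p.1).toReal

lemma measurable_nextPick_density (k : ℕ) :
    Measurable (Function.uncurry fun (p : Measure ℝ × (Fin k → ℝ)) (x : ℝ) =>
      ENNReal.ofReal (totalSum p.1).toReal * pickWeight p.2 x (totalSum p.1).toReal) := by
  have hT : Measurable fun q : (Measure ℝ × (Fin k → ℝ)) × ℝ => (totalSum q.1.1).toReal :=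
    (measurable_totalSum.comp (measurable_fst.comp measurable_fst)).ennreal_toReal
  exact hT.ennreal_ofReal.mul
    (measurable_pickWeight (measurable_snd.comp measurable_fst) measurable_snd hT)

lemma nextPickKernel_apply {k : ℕ} (p : Measure ℝ × (Fin k → ℝ)) :
    nextPickKernel k p = (pickKernel p.1).withDensity fun x =>
      ENNReal.ofReal (totalSum p.1).toReal * pickWeight p.2 x (totalSum p.1).toReal := by
  rw [nextPickKernel, Kernel.withDensity_apply _ (measurable_nextPick_density k)]
  rfl

/-- The mass is not bounded uniformly, since `T - ∑ y` may be arbitrarily small for arbitrary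
arguments; s-finiteness suffices for the composition product. -/
instance (k : ℕ) : IsSFiniteKernel (nextPickKernel k) := by
  refine Kernel.IsSFiniteKernel.withDensity _ fun p x => ENNReal.mul_ne_top (by simp) ?_
  rw [pickWeight, Set.indicator_apply]
  split_ifs <;> simp

lemma nextPickKernel_lt_top {k : ℕ} (p : Measure ℝ × (Fin k → ℝ)) (A : Set ℝ) :
    nextPickKernel k p A < ∞ := by
  refine (measure_mono (Set.subset_univ A)).trans_lt ?_
  rw [nextPickKernel_apply, withDensity_apply _ MeasurableSet.univ, Measure.restrict_univ]
  refine (lintegral_mono (g := fun _ => ENNReal.ofReal (totalSum p.1).toReal *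
    ENNReal.ofReal ((totalSum p.1).toReal - ∑ l, p.2 l)⁻¹) fun x => ?_).trans_lt ?_
  · refine mul_le_mul_right ?_ _
    exact Set.indicator_le_self' (f := fun _ => ENNReal.ofReal _) (by simp) x
  · rw [lintegral_const]
    exact ENNReal.mul_lt_top (ENNReal.mul_lt_top (by simp) (by simp)) (measure_lt_top _ _)

variable {Ω : Type*} [MeasurableSpace Ω]

/-- The joint law of the point measure, the first `k` picks and the next one. -/
lemma IsSizeBiasedPermutation.map_eq_compProd {μ : Measure Ω} [IsProbabilityMeasure μ]
    {N : Ω → Measure ℝ} {J : ℕ → Ω → ℝ} (hJ : IsSizeBiasedPermutation μ N J) (hN : Measurable N)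
    (hT : ∀ᵐ ω ∂μ, totalSum (N ω) < ∞) (hpos : ∀ᵐ ω ∂μ, ∀ᵐ x ∂(N ω), 0 < x) (k : ℕ) :
    μ.map (fun ω => ((N ω, fun l : Fin k => J l ω), J k ω)) =
      (μ.map fun ω => (N ω, fun l : Fin k => J l ω)) ⊗ₘ nextPickKernel k := by
  have hZ : Measurable fun ω => (N ω, fun l : Fin k => J l ω) :=
    hN.prodMk (measurable_pi_lambda _ fun l => hJ.measurable l)
  have hm : pickSigma N J k ≤ ‹MeasurableSpace Ω› := hZ.comap_le
  have hprob : IsProbabilityMeasure (μ.map (fun ω => ((N ω, fun l : Fin k => J l ω), J k ω))) :=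
    Measure.isProbabilityMeasure_map (hZ.prodMk (hJ.measurable k)).aemeasurable
  refine Measure.ext_prod fun {S A} hS hA => ?_
  rw [Measure.map_apply (hZ.prodMk (hJ.measurable k)) (hS.prod hA),
    Measure.compProd_apply_prod hS hA, setLIntegral_map hS
      ((nextPickKernel k).measurable_coe hA) hZ]
  have hZS : MeasurableSet[pickSigma N J k] ((fun ω => (N ω, fun l : Fin k => J l ω)) ⁻¹' S) :=
    ⟨S, hS, rfl⟩
  have hJA : MeasurableSet (J k ⁻¹' A) := hJ.measurable k hA
  have hind : Integrable ((J k ⁻¹' A).indicator fun _ => (1 : ℝ)) μ :=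
    (integrable_const 1).indicator hJA
  -- Integrating the conditional probability over an event of `pickSigma` gives the joint law on the
  -- rectangle `S ×ˢ A`.
  have hcond := setIntegral_condExp hm hind hZS
  have heq : (μ⟦J k ⁻¹' A | pickSigma N J k⟧) =ᵐ[μ] fun ω =>
      (nextPickKernel k (N ω, fun l : Fin k => J l ω) A).toReal := by
    filter_upwards [hJ.condLaw k A hA, hT, hpos] with ω h1 h2 h3
    rw [h1, nextPickLaw_eq h2 h3, nextPickKernel_apply]
  rw [setIntegral_congr_ae (hm _ hZS) (heq.mono fun ω h _ => h)] at hcond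
  have hint : Integrable (fun ω =>
      (nextPickKernel k (N ω, fun l : Fin k => J l ω) A).toReal) μ :=
    integrable_condExp.congr heq
  have h1 : ∫⁻ ω in (fun ω => (N ω, fun l : Fin k => J l ω)) ⁻¹' S,
      nextPickKernel k (N ω, fun l : Fin k => J l ω) A ∂μ = ENNReal.ofReal
        (∫ ω in (fun ω => (N ω, fun l : Fin k => J l ω)) ⁻¹' S,
          (nextPickKernel k (N ω, fun l : Fin k => J l ω) A).toReal ∂μ) := by
    rw [ofReal_integral_eq_lintegral_ofReal hint.integrableOn
      (Eventually.of_forall fun ω => ENNReal.toReal_nonneg)]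
    exact lintegral_congr fun ω => (ENNReal.ofReal_toReal (nextPickKernel_lt_top _ _).ne).symm
  rw [h1, hcond, integral_indicator hJA, setIntegral_const, measureReal_def,
    Measure.restrict_apply hJA, smul_eq_mul, mul_one, ENNReal.ofReal_toReal (measure_ne_top _ _),
    Set.inter_comm]
  rfl

/-- The density of the first `n` size-biased picks with respect to `∏ xᵢ M(dxᵢ)`, when
`T(M) = t`. -/
noncomputable def seqWeight {n : ℕ} (x : Fin n → ℝ) (t : ℝ) : ℝ≥0∞ :=
  ∏ i, {x : Fin n → ℝ | ∀ j < i, x i ≠ x j}.indicator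
    (fun x => ENNReal.ofReal (t - ∑ j ∈ Finset.Iio i, x j)⁻¹) x

lemma measurable_seqWeight {n : ℕ} {A : Type*} [MeasurableSpace A] {x : A → Fin n → ℝ}
    {t : A → ℝ} (hx : Measurable x) (ht : Measurable t) :
    Measurable fun a => seqWeight (x a) (t a) := by
  refine Finset.measurable_prod _ fun i _ => ?_
  have h : (fun a => {x : Fin n → ℝ | ∀ j < i, x i ≠ x j}.indicator
      (fun x => ENNReal.ofReal (t a - ∑ j ∈ Finset.Iio i, x j)⁻¹) (x a)) =
      {a | ∀ j < i, x a i ≠ x a j}.indicator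
      (fun a => ENNReal.ofReal (t a - ∑ j ∈ Finset.Iio i, x a j)⁻¹) := by
    funext a
    simp [Set.indicator_apply]
  rw [h]
  refine Measurable.indicator (by fun_prop) ?_
  simp only [Set.ofPred_forall]
  exact MeasurableSet.iInter fun j => MeasurableSet.iInter fun _ =>
    (measurableSet_eq_fun (by fun_prop) (by fun_prop)).compl

/-- The chain rule behind the induction on the number of picks. -/
lemma seqWeight_snoc {n : ℕ} (y : Fin n → ℝ) (x t : ℝ) :
    seqWeight (Fin.snoc (α := fun _ => ℝ) y x) t = seqWeight y t * pickWeight y x t := by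
  rw [seqWeight, Fin.prod_univ_castSucc, seqWeight, pickWeight]
  congr 1
  · refine Finset.prod_congr rfl fun i _ => ?_
    have hiff : (∀ j < i.castSucc, y i ≠ Fin.snoc (α := fun _ => ℝ) y x j) ↔ ∀ j < i, y i ≠ y j := by
      simp [Fin.forall_fin_succ', (Fin.castSucc_lt_last i).not_gt]
    simp only [Set.indicator_apply, Set.mem_ofPred_eq, Fin.Iio_castSucc, Finset.sum_map,
      Fin.coe_castSuccEmb, Fin.snoc_castSucc, hiff]
  · simp [Set.indicator_apply, Fin.forall_fin_succ', Fin.Iio_last_eq_map, Fin.castSucc_lt_last]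

lemma measurable_snoc {n : ℕ} :
    Measurable fun p : (Fin n → ℝ) × ℝ =>
      (Fin.snoc (α := fun _ => ℝ) p.1 p.2 : Fin (n + 1) → ℝ) := by
  refine measurable_pi_iff.2 fun i => ?_
  refine Fin.lastCases ?_ (fun i => ?_) i
  · simpa using measurable_snd
  · simpa using! (measurable_pi_apply i).comp measurable_fst

lemma lintegral_pi_snoc {n : ℕ} (ν : Measure ℝ) [SigmaFinite ν] {g : (Fin (n + 1) → ℝ) → ℝ≥0∞}
    (hg : Measurable g) :
    ∫⁻ x, g x ∂(Measure.pi fun _ => ν) =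
      ∫⁻ y, ∫⁻ x, g (Fin.snoc (α := fun _ => ℝ) y x) ∂ν ∂(Measure.pi fun _ : Fin n => ν) := by
  rw [← ((measurePreserving_piFinSuccAbove (fun _ : Fin (n + 1) => ν)
    (Fin.last n)).symm).lintegral_comp hg]
  rw [lintegral_prod_symm' (fun q => g ((MeasurableEquiv.piFinSuccAbove (fun _ => ℝ)
    (Fin.last n)).symm q)) (hg.comp (MeasurableEquiv.measurable _))]
  simp only [MeasurableEquiv.piFinSuccAbove_symm_apply, Fin.insertNthEquiv,
      Equiv.coe_fn_mk, Fin.insertNth_last']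

/-- The joint law of the point measure and the first `n` picks. -/
lemma IsSizeBiasedPermutation.lintegral_eq {μ : Measure Ω} [IsProbabilityMeasure μ]
    {N : Ω → Measure ℝ} {J : ℕ → Ω → ℝ} (hJ : IsSizeBiasedPermutation μ N J) (hN : Measurable N)
    (hT : ∀ᵐ ω ∂μ, totalSum (N ω) < ∞) (hpos : ∀ᵐ ω ∂μ, ∀ᵐ x ∂(N ω), 0 < x) (n : ℕ) :
    ∀ {G : (Fin n → ℝ) × Measure ℝ → ℝ≥0∞}, Measurable G →
    ∫⁻ ω, G (fun i => J i ω, N ω) ∂μ =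
      ∫⁻ ω, ENNReal.ofReal (totalSum (N ω)).toReal ^ n *
        ∫⁻ x, seqWeight x (totalSum (N ω)).toReal * G (x, N ω)
          ∂(Measure.pi fun _ : Fin n => pickKernel (N ω)) ∂μ := by
  induction n with
  | zero =>
    intro G hG
    refine lintegral_congr fun ω => ?_
    rw [Measure.pi_of_empty _ (fun i : Fin 0 => J i ω), lintegral_dirac]
    simp [seqWeight]
  | succ n ih =>
    intro G hG
    have hZ : Measurable fun ω => (N ω, fun l : Fin n => J l ω) :=
      hN.prodMk (measurable_pi_lambda _ fun l => hJ.measurable l)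
    have hG1 : Measurable fun q : (Measure ℝ × (Fin n → ℝ)) × ℝ =>
        G (Fin.snoc (α := fun _ => ℝ) q.1.2 q.2, q.1.1) :=
      hG.comp ((measurable_snoc.comp ((measurable_snd.comp measurable_fst).prodMk
        measurable_snd)).prodMk (measurable_fst.comp measurable_fst))
    have hsnoc : ∀ ω, (fun i : Fin (n + 1) => J i ω) =
        Fin.snoc (α := fun _ => ℝ) (fun l : Fin n => J l ω) (J n ω) := by
      intro ω
      funext i
      refine Fin.lastCases ?_ (fun i => ?_) i <;> simp
    have h1 : ∫⁻ ω, G (fun i => J i ω, N ω) ∂μ = ∫⁻ ω, ∫⁻ x,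
        G (Fin.snoc (α := fun _ => ℝ) (fun l : Fin n => J l ω) x, N ω)
          ∂(nextPickKernel n (N ω, fun l : Fin n => J l ω)) ∂μ := by
      have := congrArg (fun m => ∫⁻ q, G (Fin.snoc (α := fun _ => ℝ) q.1.2 q.2, q.1.1) ∂m)
        (hJ.map_eq_compProd hN hT hpos n)
      rw [lintegral_map hG1 (hZ.prodMk (hJ.measurable n)), Measure.lintegral_compProd hG1,
        lintegral_map hG1.lintegral_kernel_prod_right' hZ] at this
      simp_rw [hsnoc]
      exact this
    -- Integrating out the last pick leaves a function of the first `n` picks and of `N`, to which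
    -- the induction hypothesis applies.
    have hG2 : Measurable fun p : (Fin n → ℝ) × Measure ℝ => ∫⁻ x,
        G (Fin.snoc (α := fun _ => ℝ) p.1 x, p.2) ∂(nextPickKernel n (p.2, p.1)) :=
      (hG1.lintegral_kernel_prod_right' (κ := nextPickKernel n)).comp measurable_swap
    rw [h1, ih hG2]
    refine lintegral_congr fun ω => ?_
    have hsw : Measurable fun x : Fin (n + 1) → ℝ => seqWeight x (totalSum (N ω)).toReal :=
      measurable_seqWeight measurable_id measurable_const
    have hswG : Measurable fun x : Fin (n + 1) → ℝ =>
        seqWeight x (totalSum (N ω)).toReal * G (x, N ω) :=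
      hsw.mul (hG.comp (measurable_id.prodMk measurable_const))
    rw [lintegral_pi_snoc _ hswG, pow_succ, mul_assoc]
    congr 1
    rw [← lintegral_const_mul' _ _ (by simp)]
    refine lintegral_congr fun y => ?_
    have hGy : Measurable fun x => G (Fin.snoc (α := fun _ => ℝ) y x, N ω) :=
      hG1.comp ((measurable_const (a := (N ω, y))).prodMk measurable_id)
    have hwy : Measurable fun x => pickWeight y x (totalSum (N ω)).toReal :=
      measurable_pickWeight measurable_const measurable_id measurable_const
    rw [nextPickKernel_apply, lintegral_withDensity_eq_lintegral_mul _ (hwy.const_mul _) hGy]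
    simp only [Pi.mul_apply, seqWeight_snoc, mul_assoc]
    have hwG : Measurable fun x => pickWeight y x (totalSum (N ω)).toReal *
        G (Fin.snoc (α := fun _ => ℝ) y x, N ω) := hwy.mul hGy
    rw [lintegral_const_mul _ hwG, lintegral_const_mul _ hwG]
    ring

end NegBin

namespace NegBin

/-! ### The moment measure off the diagonals -/

open Filter Topology

/-- The product law of `n` independent size-biased picks, as a kernel. -/
noncomputable def pickPower (n : ℕ) : Kernel (Measure ℝ) (Fin n → ℝ) where
  toFun M := Measure.pi fun _ => pickKernel M
  measurable' := measurable_pi pickKernel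

lemma pickPower_apply (n : ℕ) (M : Measure ℝ) :
    pickPower n M = Measure.pi fun _ => pickKernel M := rfl

instance (n : ℕ) : IsFiniteKernel (pickPower n) where
  exists_univ_le := ⟨1, ENNReal.one_lt_top, fun M => by
    rw [pickPower_apply, Measure.pi_univ]
    refine Finset.prod_le_one' fun _ _ => ?_
    rw [pickKernel_apply, Measure.smul_apply, sizeBiased_univ, smul_eq_mul]
    exact ENNReal.inv_mul_le_one _⟩

variable {Ω : Type*} [MeasurableSpace Ω]

/-- The measure `E[∏ xᵢ N(dxᵢ); T ∈ dt]`, for `T < ∞`. -/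
noncomputable def momentMeasure (μ : Measure Ω) (N : Ω → Measure ℝ) (hN : Measurable N) (n : ℕ) :
    Measure ((Fin n → ℝ) × ℝ) :=
  ((μ.withDensity fun ω => ENNReal.ofReal (totalSum (N ω)).toReal ^ n) ⊗ₘ
    ((pickPower n).comap N hN)).map fun q => (q.2, (totalSum (N q.1)).toReal)

lemma lintegral_momentMeasure {μ : Measure Ω} [SFinite μ] {N : Ω → Measure ℝ} (hN : Measurable N)
    {n : ℕ} {F : (Fin n → ℝ) × ℝ → ℝ≥0∞} (hF : Measurable F) :
    ∫⁻ p, F p ∂(momentMeasure μ N hN n) =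
      ∫⁻ ω, ENNReal.ofReal (totalSum (N ω)).toReal ^ n *
        ∫⁻ x, F (x, (totalSum (N ω)).toReal) ∂(Measure.pi fun _ : Fin n => pickKernel (N ω)) ∂μ := by
  have hT : Measurable fun ω => (totalSum (N ω)).toReal :=
    (measurable_totalSum.comp hN).ennreal_toReal
  have hφ : Measurable fun q : Ω × (Fin n → ℝ) => (q.2, (totalSum (N q.1)).toReal) :=
    measurable_snd.prodMk (hT.comp measurable_fst)
  have hFφ : Measurable fun q : Ω × (Fin n → ℝ) => F (q.2, (totalSum (N q.1)).toReal) :=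
    hF.comp hφ
  rw [momentMeasure, lintegral_map hF hφ, Measure.lintegral_compProd hFφ,
    lintegral_withDensity_eq_lintegral_mul _ (hT.ennreal_ofReal.pow_const n)
      hFφ.lintegral_kernel_prod_right']
  rfl

/-- The pick density sees `N` only through its sum, so it is a function of the image point `(x, t)`
and factors out of the average over `N`. -/
lemma IsSizeBiasedPermutation.map_eq_withDensity {μ : Measure Ω} [IsProbabilityMeasure μ]
    {N : Ω → Measure ℝ} {J : ℕ → Ω → ℝ} (hJ : IsSizeBiasedPermutation μ N J) (hN : Measurable N)
    (hT : ∀ᵐ ω ∂μ, totalSum (N ω) < ∞) (hpos : ∀ᵐ ω ∂μ, ∀ᵐ x ∂(N ω), 0 < x) (n : ℕ) :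
    μ.map (fun ω => ((fun i : Fin n => J i ω), (totalSum (N ω)).toReal)) =
      (momentMeasure μ N hN n).withDensity fun p => seqWeight p.1 p.2 := by
  ext S hS
  have hTm : Measurable fun ω => (totalSum (N ω)).toReal :=
    (measurable_totalSum.comp hN).ennreal_toReal
  have hm : Measurable fun ω => ((fun i : Fin n => J i ω), (totalSum (N ω)).toReal) :=
    (measurable_pi_lambda (fun ω (i : Fin n) => J i ω) fun l => hJ.measurable l).prodMk hTm
  have hw : Measurable fun p : (Fin n → ℝ) × ℝ => seqWeight p.1 p.2 :=
    measurable_seqWeight measurable_fst measurable_snd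
  have hψ : Measurable fun p : (Fin n → ℝ) × Measure ℝ => (p.1, (totalSum p.2).toReal) :=
    measurable_fst.prodMk (measurable_totalSum.comp measurable_snd).ennreal_toReal
  have hS1 : Measurable (S.indicator (1 : (Fin n → ℝ) × ℝ → ℝ≥0∞)) := measurable_one.indicator hS
  rw [withDensity_apply _ hS, ← lintegral_indicator hS,
    lintegral_momentMeasure hN (hw.indicator hS), ← lintegral_indicator_one hS,
    lintegral_map hS1 hm, hJ.lintegral_eq hN hT hpos n (G := fun p =>
      S.indicator 1 (p.1, (totalSum p.2).toReal)) (hS1.comp hψ)]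
  refine lintegral_congr fun ω => ?_
  congr 1
  refine lintegral_congr fun x => ?_
  by_cases hx : (x, (totalSum (N ω)).toReal) ∈ S <;> simp [hx]

section Comparison

variable {Ω' : Type*} [MeasurableSpace Ω'] {n : ℕ}

/-- The measure `r⁽ⁿ⁾ ∏ xᵢ Q(dxᵢ) P(T' ∈ d(t - ∑ xᵢ))`. -/
noncomputable def shiftedMeasure (r n : ℕ) (Q : Measure ℝ) (L : Measure ℝ) :
    Measure ((Fin n → ℝ) × ℝ) :=
  (r.ascFactorial n : ℝ≥0∞) •
    ((Measure.pi fun _ : Fin n => sizeBiased Q).prod L).map fun p => (p.1, p.2 + ∑ i, p.1 i)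

/-- On a product of sets the moment measure is `E[∏ ∫_{B_i} x N(dx); T ∈ C]`, so the statement
reduces to the law of the sum. Disjointness keeps away from the diagonals, where a point of `N`
counted twice adds mass to the moment measure. -/
lemma IsNegBinomialProcess.momentMeasure_box {μ : Measure Ω} [IsProbabilityMeasure μ]
    {N : Ω → Measure ℝ} {r : ℕ} {Q : Measure ℝ} (hN : IsNegBinomialProcess μ N r Q)
    {μ' : Measure Ω'} [IsProbabilityMeasure μ'] {N' : Ω' → Measure ℝ}
    (hN' : IsNegBinomialProcess μ' N' (r + n) Q) (hQ : totalSum Q ≠ ∞) (hpos : ∀ᵐ x ∂Q, 0 < x)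
    {B : Fin n → Set ℝ} (hB : ∀ i, MeasurableSet (B i))
    (hdisj : ∀ i j, i ≠ j → Disjoint (B i) (B j)) {C : Set ℝ} (hC : MeasurableSet C) :
    momentMeasure μ N hN.measurable n ((Set.univ.pi B) ×ˢ C) =
      shiftedMeasure r n Q (μ'.map fun ω => (totalSum (N' ω)).toReal) ((Set.univ.pi B) ×ˢ C) := by
  have hfinQ : IsFiniteMeasure (sizeBiased Q) := ⟨by rw [sizeBiased_univ]; exact hQ.lt_top⟩
  have hT : Measurable fun ω => (totalSum (N ω)).toReal :=
    (measurable_totalSum.comp hN.measurable).ennreal_toReal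
  have hBox : MeasurableSet ((Set.univ.pi B) ×ˢ C) := (MeasurableSet.univ_pi hB).prod hC
  have h := congrArg (fun m => m C) (hN.map_withDensity_eq hN' hQ hpos hB hdisj)
  simp only [Measure.smul_apply] at h
  rw [Measure.map_apply hT hC, Measure.map_apply (by fun_prop) hC,
    withDensity_apply _ (hT hC), ← lintegral_indicator (hT hC)] at h
  rw [shiftedMeasure, Measure.smul_apply, Measure.map_apply (by fun_prop) hBox,
    ← lintegral_indicator_one hBox, lintegral_momentMeasure hN.measurable
      (measurable_one.indicator hBox)]
  refine Eq.trans ?_ (h.trans ?_)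
  · refine lintegral_congr_ae ((hN.totalSum_lt_top hQ).mono fun ω hω => ?_)
    have hind : ∀ x : Fin n → ℝ, ((Set.univ.pi B) ×ˢ C).indicator (1 : (Fin n → ℝ) × ℝ → ℝ≥0∞)
        (x, (totalSum (N ω)).toReal) = C.indicator 1 (totalSum (N ω)).toReal *
          (Set.univ.pi B).indicator 1 x := by
      intro x
      rw [mul_comm]
      exact Set.indicator_prod_one
    simp_rw [hind]
    rw [lintegral_const_mul _ (measurable_one.indicator (MeasurableSet.univ_pi hB)),
      lintegral_indicator_one (MeasurableSet.univ_pi hB), Measure.pi_pi]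
    -- One factor `T` goes to each pick kernel and undoes its normalisation.
    have hprod : ENNReal.ofReal (totalSum (N ω)).toReal ^ n * ∏ i, pickKernel (N ω) (B i) =
        ∏ i, sizeBiased (N ω) (B i) := by
      have hcard : ENNReal.ofReal (totalSum (N ω)).toReal ^ n =
        ∏ _i : Fin n, ENNReal.ofReal (totalSum (N ω)).toReal := by simp
      rw [hcard, ← Finset.prod_mul_distrib]
      refine Finset.prod_congr rfl fun i _ => ?_
      rw [← smul_pickKernel hω, Measure.smul_apply, smul_eq_mul]
    rw [mul_left_comm, hprod]
    by_cases hωC : (totalSum (N ω)).toReal ∈ C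
    · simp [hωC]
    · simp [hωC]
  · congr 1
    rw [← Measure.restrict_pi_pi]
    have hr : ((Measure.pi fun _ : Fin n => sizeBiased Q).restrict (Set.univ.pi B)).prod
        (μ'.map fun ω => (totalSum (N' ω)).toReal) =
        ((Measure.pi fun _ : Fin n => sizeBiased Q).prod
          (μ'.map fun ω => (totalSum (N' ω)).toReal)).restrict ((Set.univ.pi B) ×ˢ Set.univ) := by
      rw [← Measure.prod_restrict, Measure.restrict_univ]
    have hmC : MeasurableSet ((fun p : (Fin n → ℝ) × ℝ => p.2 + ∑ i, p.1 i) ⁻¹' C) :=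
      measurableSet_preimage (by fun_prop) hC
    rw [hr, Measure.restrict_apply hmC]
    congr 1
    ext p
    simp [and_comm]

/-- Intersecting a box with disjoint sides with any box leaves the sides disjoint, so the previous
lemma holds on a whole π-system. -/
lemma IsNegBinomialProcess.momentMeasure_restrict_box {μ : Measure Ω} [IsProbabilityMeasure μ]
    {N : Ω → Measure ℝ} {r : ℕ} {Q : Measure ℝ} (hN : IsNegBinomialProcess μ N r Q)
    {μ' : Measure Ω'} [IsProbabilityMeasure μ'] {N' : Ω' → Measure ℝ}
    (hN' : IsNegBinomialProcess μ' N' (r + n) Q) (hQ : totalSum Q ≠ ∞) (hpos : ∀ᵐ x ∂Q, 0 < x)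
    {B : Fin n → Set ℝ} (hB : ∀ i, MeasurableSet (B i))
    (hdisj : ∀ i j, i ≠ j → Disjoint (B i) (B j)) :
    (momentMeasure μ N hN.measurable n).restrict ((Set.univ.pi B) ×ˢ Set.univ) =
      (shiftedMeasure r n Q (μ'.map fun ω => (totalSum (N' ω)).toReal)).restrict
        ((Set.univ.pi B) ×ˢ Set.univ) := by
  have hfinQ : IsFiniteMeasure (sizeBiased Q) := ⟨by rw [sizeBiased_univ]; exact hQ.lt_top⟩
  have hfin2 : IsFiniteMeasure (shiftedMeasure r n Q
      (μ'.map fun ω => (totalSum (N' ω)).toReal)) := Measure.smul_finite _ (by simp)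
  have hkey : ∀ {A : Fin n → Set ℝ} {C : Set ℝ}, (∀ i, MeasurableSet (A i)) → MeasurableSet C →
      (momentMeasure μ N hN.measurable n).restrict ((Set.univ.pi B) ×ˢ Set.univ)
        ((Set.univ.pi A) ×ˢ C) =
      (shiftedMeasure r n Q (μ'.map fun ω => (totalSum (N' ω)).toReal)).restrict
        ((Set.univ.pi B) ×ˢ Set.univ) ((Set.univ.pi A) ×ˢ C) := by
    intro A C hA hC
    rw [Measure.restrict_apply ((MeasurableSet.univ_pi hA).prod hC),
      Measure.restrict_apply ((MeasurableSet.univ_pi hA).prod hC), Set.prod_inter_prod,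
      Set.inter_univ, ← Set.pi_inter_distrib]
    exact hN.momentMeasure_box hN' hQ hpos (fun i => (hA i).inter (hB i))
      (fun i j hij => (hdisj i j hij).mono Set.inter_subset_right Set.inter_subset_right) hC
  have hfin1 : IsFiniteMeasure ((momentMeasure μ N hN.measurable n).restrict
      ((Set.univ.pi B) ×ˢ Set.univ)) := by
    refine ⟨?_⟩
    have h := hkey (A := fun _ => Set.univ) (fun _ => MeasurableSet.univ) MeasurableSet.univ
    rw [Set.pi_univ, Set.univ_prod_univ] at h
    rw [h]
    exact measure_lt_top _ _
  refine Measure.ext_prod fun {S C} hS hC => ?_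
  -- With `C` fixed, both sides become measures in `S` alone, and boxes generate the σ-algebra of
  -- `Fin n → ℝ`.
  have hmap : ∀ (m : Measure ((Fin n → ℝ) × ℝ)) {S : Set (Fin n → ℝ)}, MeasurableSet S →
      (m.restrict (Set.univ ×ˢ C)).map Prod.fst S = m (S ×ˢ C) := by
    intro m S hS
    rw [Measure.map_apply measurable_fst hS, Measure.restrict_apply (measurable_fst hS)]
    congr 1
    ext p
    simp
  rw [← hmap _ hS, ← hmap _ hS]
  congr 1
  refine ext_of_generate_finite _ generateFrom_pi.symm isPiSystem_pi ?_ ?_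
  · rintro _ ⟨A, hA, rfl⟩
    have hA' : ∀ i, MeasurableSet (A i) := fun i => hA i (Set.mem_univ i)
    rw [hmap _ (MeasurableSet.univ_pi hA'), hmap _ (MeasurableSet.univ_pi hA'), hkey hA' hC]
  · rw [hmap _ MeasurableSet.univ, hmap _ MeasurableSet.univ, ← Set.pi_univ Set.univ]
    exact hkey (fun _ => MeasurableSet.univ) hC

/-- Hausdorff separation, with the neighbourhoods shrunk into a countable basis so that countably
many boxes cover all injective tuples. -/
lemma exists_disjoint_basis_box {x : Fin n → ℝ} (hx : Function.Injective x) :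
    ∃ B : Fin n → TopologicalSpace.countableBasis ℝ,
      (∀ i j, i ≠ j → Disjoint (B i : Set ℝ) (B j : Set ℝ)) ∧ ∀ i, x i ∈ (B i : Set ℝ) := by
  obtain ⟨U, hU, hd⟩ := (Set.finite_range x).t2_separation
  have hB : ∀ i, ∃ V ∈ TopologicalSpace.countableBasis ℝ, x i ∈ V ∧ V ⊆ U (x i) := fun i =>
    (TopologicalSpace.isBasis_countableBasis ℝ).exists_subset_of_mem_open (hU _).1 (hU _).2
  choose V hV hxV hVU using hB
  exact ⟨fun i => ⟨V i, hV i⟩, fun i j hij => (hd (Set.mem_range_self i) (Set.mem_range_self j)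
    (hx.ne hij)).mono (hVU i) (hVU j), hxV⟩

lemma injective_of_seqWeight_ne_zero {x : Fin n → ℝ} {t : ℝ} (h : seqWeight x t ≠ 0) :
    Function.Injective x := by
  have hlt : ∀ i, ∀ j < i, x i ≠ x j := by
    intro i
    have := Finset.prod_ne_zero_iff.1 h i (Finset.mem_univ i)
    exact Set.mem_of_indicator_ne_zero this
  intro i j hij
  rcases lt_trichotomy i j with h1 | h1 | h1
  · exact absurd hij.symm (hlt j i h1)
  · exact h1
  · exact absurd hij (hlt i j h1)

/-- The weight vanishes on tuples with repetitions, so agreement on the countable union of boxes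
with disjoint sides is enough. -/
lemma IsNegBinomialProcess.momentMeasure_withDensity {μ : Measure Ω} [IsProbabilityMeasure μ]
    {N : Ω → Measure ℝ} {r : ℕ} {Q : Measure ℝ} (hN : IsNegBinomialProcess μ N r Q)
    {μ' : Measure Ω'} [IsProbabilityMeasure μ'] {N' : Ω' → Measure ℝ}
    (hN' : IsNegBinomialProcess μ' N' (r + n) Q) (hQ : totalSum Q ≠ ∞) (hpos : ∀ᵐ x ∂Q, 0 < x) :
    ((momentMeasure μ N hN.measurable n).withDensity fun p => seqWeight p.1 p.2) =
      (shiftedMeasure r n Q (μ'.map fun ω => (totalSum (N' ω)).toReal)).withDensity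
        fun p => seqWeight p.1 p.2 := by
  let box : {B : Fin n → TopologicalSpace.countableBasis ℝ //
      ∀ i j, i ≠ j → Disjoint (B i : Set ℝ) (B j : Set ℝ)} → Set ((Fin n → ℝ) × ℝ) :=
    fun B => (Set.univ.pi fun i => (B.1 i : Set ℝ)) ×ˢ Set.univ
  have hmeas : ∀ (B : Fin n → TopologicalSpace.countableBasis ℝ) i,
      MeasurableSet (B i : Set ℝ) := fun B i =>
    ((TopologicalSpace.isBasis_countableBasis ℝ).isOpen (B i).2).measurableSet
  have hres : (momentMeasure μ N hN.measurable n).restrict (⋃ B, box B) =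
      (shiftedMeasure r n Q (μ'.map fun ω => (totalSum (N' ω)).toReal)).restrict (⋃ B, box B) :=
    Measure.restrict_iUnion_congr.2 fun B =>
      hN.momentMeasure_restrict_box hN' hQ hpos (hmeas B.1) B.2
  have hU : MeasurableSet (⋃ B, box B) := MeasurableSet.iUnion fun B =>
    (MeasurableSet.univ_pi (hmeas B.1)).prod MeasurableSet.univ
  have hind : (fun p : (Fin n → ℝ) × ℝ => seqWeight p.1 p.2) =
      (⋃ B, box B).indicator fun p => seqWeight p.1 p.2 := by
    refine (Set.indicator_eq_self.2 fun p hp => ?_).symm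
    obtain ⟨B, hBd, hB⟩ := exists_disjoint_basis_box (injective_of_seqWeight_ne_zero hp)
    exact Set.mem_iUnion.2 ⟨⟨B, hBd⟩, fun i _ => hB i, Set.mem_univ _⟩
  rw [hind, withDensity_indicator hU, withDensity_indicator hU, hres]

end Comparison

end NegBin

namespace NegBin

/-! ### The intensity `α x ^ (-α - 1)` and the final density -/

open Filter Topology

lemma tildeLambda_pos (α : ℝ) : ∀ᵐ x ∂(tildeLambda α), 0 < x :=
  (withDensity_absolutelyContinuous _ _).ae_le
    ((ae_restrict_mem measurableSet_Ioo).mono fun _ hx => hx.1)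

lemma sizeBiased_tildeLambda {α : ℝ} :
    sizeBiased (tildeLambda α) =
      (volume.restrict (Set.Ioo (0 : ℝ) 1)).withDensity fun x => ENNReal.ofReal (α * x ^ (-α)) := by
  rw [sizeBiased, tildeLambda, ← withDensity_mul _ (by fun_prop) ENNReal.measurable_ofReal]
  refine withDensity_congr_ae ((ae_restrict_mem measurableSet_Ioo).mono fun x hx => ?_)
  simp only [Pi.mul_apply]
  rw [← ENNReal.ofReal_mul' hx.1.le, mul_assoc]
  congr 2
  nth_rewrite 2 [← Real.rpow_one x]
  rw [← Real.rpow_add hx.1]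
  congr 1
  ring

lemma totalSum_tildeLambda {α : ℝ} (hα₁ : α < 1) : totalSum (tildeLambda α) ≠ ∞ := by
  rw [← sizeBiased_univ, sizeBiased_tildeLambda, withDensity_apply _ MeasurableSet.univ,
    Measure.restrict_univ]
  have hint : IntegrableOn (fun x : ℝ => x ^ (-α)) (Set.Ioo 0 1) :=
    (intervalIntegral.integrableOn_Ioo_rpow_iff one_pos).2 (by linarith)
  exact (hint.const_mul α).lintegral_lt_top.ne

variable {n : ℕ}

/-- Each diagonal `x i = x j` is a proper subspace, hence null. -/
lemma ae_injective_volume :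
    ∀ᵐ x ∂(volume : Measure (Fin n → ℝ)), Function.Injective x := by
  have h : ∀ i j : Fin n, i ≠ j → ∀ᵐ x ∂(volume : Measure (Fin n → ℝ)), x i ≠ x j := by
    intro i j hij
    let V : Submodule ℝ (Fin n → ℝ) :=
      LinearMap.ker (LinearMap.proj (R := ℝ) (φ := fun _ : Fin n => ℝ) i - LinearMap.proj j)
    have hV : V ≠ ⊤ := by
      intro hV
      have : (Pi.single i 1 : Fin n → ℝ) ∈ V := hV ▸ Submodule.mem_top
      simp [V, hij.symm] at this
    have := Measure.addHaar_submodule volume V hV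
    refine measure_mono_null (fun x hx => ?_) this
    have hx' : x i = x j := not_not.1 hx
    simp [V, hx']
  have h' : ∀ᵐ x ∂(volume : Measure (Fin n → ℝ)), ∀ i j : Fin n, i ≠ j → x i ≠ x j :=
    eventually_all.2 fun i => eventually_all.2 fun j => by
      by_cases hij : i = j
      · exact Eventually.of_forall fun x hn => absurd hij hn
      · exact (h i j hij).mono fun x hx _ => hx
  exact h'.mono fun x hx i j hij => by_contra fun hn => hx i j hn hij

lemma map_withDensity_comp {A B : Type*} [MeasurableSpace A] [MeasurableSpace B] (ν : Measure A)
    {φ : A → B} (hφ : Measurable φ) {g : B → ℝ≥0∞} (hg : Measurable g) :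
    (ν.withDensity (g ∘ φ)).map φ = (ν.map φ).withDensity g := by
  ext S hS
  rw [Measure.map_apply hφ hS, withDensity_apply _ (hφ hS), withDensity_apply _ hS,
    setLIntegral_map hS hg hφ]
  rfl

/-- The measure `dx P(T' ∈ d(t - ∑ xᵢ))` on `(0,1)ⁿ × ℝ`. -/
noncomputable def lebesgueShift (n : ℕ) (L : Measure ℝ) : Measure ((Fin n → ℝ) × ℝ) :=
  ((volume.restrict (Set.univ.pi fun _ : Fin n => Set.Ioo (0 : ℝ) 1)).prod L).map
    fun p => (p.1, p.2 + ∑ i, p.1 i)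

/-- The density involves only `x`, which the map `(x, s) ↦ (x, s + ∑ x_i)` leaves fixed, so it
passes through the image. -/
lemma shiftedMeasure_tildeLambda {α : ℝ} (hα₁ : α < 1) (r : ℕ) (L : Measure ℝ) [SFinite L] :
    shiftedMeasure r n (tildeLambda α) L =
      (r.ascFactorial n : ℝ≥0∞) • (lebesgueShift n L).withDensity
        fun p => ∏ i, ENNReal.ofReal (α * p.1 i ^ (-α)) := by
  have hfin : IsFiniteMeasure ((volume.restrict (Set.Ioo (0 : ℝ) 1)).withDensity
      fun x => ENNReal.ofReal (α * x ^ (-α))) := by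
    rw [← sizeBiased_tildeLambda]
    exact ⟨by rw [sizeBiased_univ]; exact (totalSum_tildeLambda hα₁).lt_top⟩
  have hf : Measurable fun x : ℝ => ENNReal.ofReal (α * x ^ (-α)) := by fun_prop
  have hF : Measurable fun x : Fin n → ℝ => ∏ i, ENNReal.ofReal (α * x i ^ (-α)) :=
    Finset.measurable_prod _ fun i _ => hf.comp (measurable_pi_apply i)
  rw [shiftedMeasure, sizeBiased_tildeLambda, pi_withDensity _ hf, ← Measure.restrict_pi_pi,
    ← volume_pi, prod_withDensity_left hF, lebesgueShift,
    ← map_withDensity_comp _ (by fun_prop)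
      (g := fun p : (Fin n → ℝ) × ℝ => ∏ i, ENNReal.ofReal (α * p.1 i ^ (-α)))
      (hF.comp measurable_fst)]
  rfl

lemma lebesgueShift_ae {L : Measure ℝ} [SFinite L] (hL : ∀ᵐ s ∂L, 0 ≤ s) :
    ∀ᵐ p ∂(lebesgueShift n L), (∀ i, 0 < p.1 i) ∧ Function.Injective p.1 ∧
      ∑ i, p.1 i ≤ p.2 := by
  have h1 : ∀ᵐ p ∂((volume.restrict (Set.univ.pi fun _ : Fin n => Set.Ioo (0 : ℝ) 1)).prod L),
      (∀ i, 0 < p.1 i) ∧ Function.Injective p.1 := by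
    refine Measure.quasiMeasurePreserving_fst.ae
      (p := fun x : Fin n → ℝ => (∀ i, 0 < x i) ∧ Function.Injective x) ?_
    filter_upwards [ae_restrict_mem (MeasurableSet.univ_pi fun _ => measurableSet_Ioo),
      ae_restrict_of_ae ae_injective_volume] with x hx1 hx2
    exact ⟨fun i => (hx1 i (Set.mem_univ i)).1, hx2⟩
  have h2 : ∀ᵐ p ∂((volume.restrict (Set.univ.pi fun _ : Fin n => Set.Ioo (0 : ℝ) 1)).prod L),
      0 ≤ p.2 := Measure.quasiMeasurePreserving_snd.ae (p := fun s : ℝ => 0 ≤ s) hL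
  have hinj : MeasurableSet {p : (Fin n → ℝ) × ℝ | Function.Injective p.1} := by
    have : {p : (Fin n → ℝ) × ℝ | Function.Injective p.1} =
        ⋂ i, ⋂ j, {p | p.1 i = p.1 j → i = j} := by
      ext p; simp [Function.Injective]
    rw [this]
    refine MeasurableSet.iInter fun i => MeasurableSet.iInter fun j => ?_
    by_cases hij : i = j
    · simp [hij]
    · have hc : {p : (Fin n → ℝ) × ℝ | p.1 i = p.1 j → i = j} = {p | p.1 i = p.1 j}ᶜ := by
        ext p; simp [hij]
      rw [hc]
      exact (measurableSet_eq_fun (by fun_prop) (by fun_prop)).compl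
  have hmeas : MeasurableSet {p : (Fin n → ℝ) × ℝ | (∀ i, 0 < p.1 i) ∧ Function.Injective p.1 ∧
      ∑ i, p.1 i ≤ p.2} := by
    have hle : MeasurableSet {p : (Fin n → ℝ) × ℝ | ∑ i, p.1 i ≤ p.2} :=
      measurableSet_le (by fun_prop) (by fun_prop)
    have hpos : MeasurableSet {p : (Fin n → ℝ) × ℝ | ∀ i, 0 < p.1 i} := by
      simp only [Set.ofPred_forall]
      exact MeasurableSet.iInter fun i => measurableSet_lt (by fun_prop) (by fun_prop)
    exact hpos.inter (hinj.inter hle)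
  rw [lebesgueShift, ae_map_iff (by fun_prop) hmeas]
  filter_upwards [h1, h2] with p hp1 hp2
  exact ⟨hp1.1, hp1.2, by simpa using hp2⟩

/-- Injectivity makes every indicator in `seqWeight` equal to one. The bound on `t` makes the
denominators nonnegative, so `ENNReal.ofReal` is multiplicative; a zero denominator is harmless
because both sides use the real inverse. -/
lemma ascFactorial_mul_prod_mul_seqWeight {α : ℝ} (hα₀ : 0 < α) (r : ℕ) {x : Fin n → ℝ} {t : ℝ}
    (hx : ∀ i, 0 < x i) (hinj : Function.Injective x) (ht : ∑ i, x i ≤ t) :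
    (r.ascFactorial n : ℝ≥0∞) * ((∏ i, ENNReal.ofReal (α * x i ^ (-α))) * seqWeight x t) =
      ENNReal.ofReal ((r.ascFactorial n : ℝ) * α ^ n *
        ∏ i, (x i ^ (-α) / (t - ∑ j ∈ Finset.Iio i, x j))) := by
  have hnn : ∀ i, 0 ≤ t - ∑ j ∈ Finset.Iio i, x j := fun i => sub_nonneg.2 <|
    (Finset.sum_le_univ_sum_of_nonneg fun j => (hx j).le).trans ht
  have hxn : ∀ i, 0 ≤ x i ^ (-α) := fun i => Real.rpow_nonneg (hx i).le _
  have hw : seqWeight x t = ∏ i, ENNReal.ofReal (t - ∑ j ∈ Finset.Iio i, x j)⁻¹ := by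
    refine Finset.prod_congr rfl fun i _ => ?_
    have hmem : x ∈ {x : Fin n → ℝ | ∀ j < i, x i ≠ x j} := fun j hj => hinj.ne hj.ne'
    exact Set.indicator_of_mem hmem _
  have hcard : α ^ n = ∏ _i : Fin n, α := by simp
  rw [hw, ← Finset.prod_mul_distrib, mul_assoc, hcard, ← Finset.prod_mul_distrib,
    ENNReal.ofReal_mul (by positivity), ENNReal.ofReal_natCast, ENNReal.ofReal_prod_of_nonneg
      fun i _ => mul_nonneg hα₀.le (div_nonneg (hxn i) (hnn i))]
  congr 1
  refine Finset.prod_congr rfl fun i _ => ?_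
  rw [← ENNReal.ofReal_mul (mul_nonneg hα₀.le (hxn i)), div_eq_mul_inv, mul_assoc]

lemma shiftedMeasure_tildeLambda_withDensity {α : ℝ} (hα₀ : 0 < α) (hα₁ : α < 1) (r : ℕ)
    (L : Measure ℝ) [SFinite L] (hL : ∀ᵐ s ∂L, 0 ≤ s) :
    ((shiftedMeasure r n (tildeLambda α) L).withDensity fun p => seqWeight p.1 p.2) =
      (lebesgueShift n L).withDensity fun p => ENNReal.ofReal ((r.ascFactorial n : ℝ) * α ^ n *
        ∏ i, (p.1 i ^ (-α) / (p.2 - ∑ j ∈ Finset.Iio i, p.1 j))) := by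
  have hF : Measurable fun p : (Fin n → ℝ) × ℝ => ∏ i, ENNReal.ofReal (α * p.1 i ^ (-α)) :=
    Finset.measurable_prod _ fun i _ => by fun_prop
  have hw : Measurable fun p : (Fin n → ℝ) × ℝ => seqWeight p.1 p.2 :=
    measurable_seqWeight measurable_fst measurable_snd
  rw [shiftedMeasure_tildeLambda hα₁, withDensity_smul_measure, ← withDensity_mul _ hF hw,
    ← withDensity_smul _ (hF.mul hw)]
  exact withDensity_congr_ae ((lebesgueShift_ae hL).mono fun p hp =>
    ascFactorial_mul_prod_mul_seqWeight hα₀ r hp.1 hp.2.1 hp.2.2)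

end NegBin

theorem proposition2p5 {Ω Ω' : Type*} [MeasurableSpace Ω] [MeasurableSpace Ω']
    (μ : Measure Ω) [IsProbabilityMeasure μ] (μ' : Measure Ω') [IsProbabilityMeasure μ']
    (α : ℝ) (hα₀ : 0 < α) (hα₁ : α < 1) (r n : ℕ) (hr : 1 ≤ r) (hn : 1 ≤ n)
    (N : Ω → Measure ℝ)
    (hN : NegBin.IsNegBinomialProcess μ N r (NegBin.tildeLambda α))
    (J : ℕ → Ω → ℝ) (hJ : NegBin.IsSizeBiasedPermutation μ N J)
    (N' : Ω' → Measure ℝ)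
    (hN' : NegBin.IsNegBinomialProcess μ' N' (r + n) (NegBin.tildeLambda α)) :
    (∀ᵐ ω ∂μ, NegBin.totalSum (N ω) < ∞) ∧
    (∀ᵐ ω ∂μ', NegBin.totalSum (N' ω) < ∞) ∧
    μ.map (fun ω => ((fun i : Fin n => J i ω), (NegBin.totalSum (N ω)).toReal)) =
      (((volume.restrict (Set.univ.pi fun _ : Fin n => Set.Ioo (0 : ℝ) 1)).prod
          (μ'.map fun ω => (NegBin.totalSum (N' ω)).toReal)).map
        (fun p : (Fin n → ℝ) × ℝ => (p.1, p.2 + ∑ i, p.1 i))).withDensity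
        (fun p : (Fin n → ℝ) × ℝ => ENNReal.ofReal
          ((r.ascFactorial n : ℝ) * α ^ n *
            ∏ i, ((p.1 i) ^ (-α) / (p.2 - ∑ j ∈ Finset.Iio i, p.1 j)))) := by
  have hQ := NegBin.totalSum_tildeLambda hα₁
  have hQpos := NegBin.tildeLambda_pos α
  have hT := hN.totalSum_lt_top hQ
  have hNpos : ∀ᵐ ω ∂μ, ∀ᵐ x ∂(N ω), 0 < x := hN.pointMeasure.mono fun ω hω =>
    measure_mono_null (fun x (hx : ¬0 < x) (h : x ∈ Set.Ioo 0 1) => hx h.1) hω.compl_Ioo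
  have hT'm : Measurable fun ω => (NegBin.totalSum (N' ω)).toReal :=
    (NegBin.measurable_totalSum.comp hN'.measurable).ennreal_toReal
  refine ⟨hT, hN'.totalSum_lt_top hQ, ?_⟩
  rw [hJ.map_eq_withDensity hN.measurable hT hNpos, hN.momentMeasure_withDensity hN' hQ hQpos,
    NegBin.shiftedMeasure_tildeLambda_withDensity hα₀ hα₁ r]
  · rfl
  · rw [ae_map_iff hT'm.aemeasurable measurableSet_Ici]
    exact Filter.Eventually.of_forall fun ω => ENNReal.toReal_nonneg
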